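/- Let $I\subseteq\mathbb R$ be a nondegenerate interval (open, closed or half-open, bounded or not); derivatives at endpoints belonging to $I$ are one-sided. Let $\mathcal C^{2\#}(I)$ be the set of twice continuously differentiable functions $f\colon I\to\mathbb R$ whose first derivative vanishes nowhere on $I$. For a continuous strictly monotone $f\colon I\to\mathbb R$, the quasiarithmetic mean generated by $f$ is the function $$\mathcal A^{[f]}\colon\bigcup_{n\ge1}I^n\to I,\qquad \mathcal A^{[f]}(a_1,\dots,a_n)=f^{-1}\Big(\frac{f(a_1)+\dots+f(a_n)}n\Big),$$ and $\mathcal Q(I)$ is the family of all these means. A mean on $I$ is called Jensen concave if for every $n\ge1$ its restriction to $I^n$ is a Jensen concave function. For $x\in\bigcup_{n\ge 1}I^n$ put $$\operatorname{conc}_{\mathcal Q(I)}(\mathcal M)(x)=\inf\{\mathcal N(x):\mathcal N\in\mathcal Q(I),\ \mathcal N\text{ is Jensen concave},\ \mathcal N\ge\mathcal M\},$$ and for $\varphi\colon I\to\mathbb R$ and $x\in I$ put $$\operatorname{conv}_{\mathcal C(I)}(\varphi)(x)=\sup\{u(x): u\colon I\to\mathbb R\text{ continuous and Jensen convex},\ u\le\varphi\}$$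 (the infimum and supremum of the empty set being $+\infty$ and $-\infty$). Let $f\in\mathcal C^{2\#}(I)$ be increasing and concave. Then there is $g\in\mathcal C^{2\#}(I)$ with $$\operatorname{conc}_{\mathcal Q(I)}(\mathcal A^{[f]})=\mathcal A^{[g]}\quad\text{on }\bigcup_{n\ge1}I^n,$$ such that either $g''\equiv0$ on $I$ and $\mathcal A^{[g]}$ is the arithmetic mean, or $g''$ and $f''$ vanish nowhere on $I$ and $$\frac{g'}{g''}=\operatorname{conv}_{\mathcal C(I)}\Big(\frac{f'}{f''}\Big)\quad\text{on }I.$$ -/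

import Mathlib

/-! Envelopes of quasiarithmetic means on an interval `I ⊆ ℝ`.

Functions with domain `D ⊆ α` are represented by total functions on `α` of which only the
values on `D` matter. -/

noncomputable section

namespace QAMeans

/-! ### Jensen convexity and envelopes -/

/-- `g` is Jensen convex on the (convex) set `D`. -/
def JensenConvexOn {X : Type*} [AddCommGroup X] [Module ℝ X] (D : Set X) (g : X → ℝ) : Prop :=
  ∀ x ∈ D, ∀ y ∈ D, g ((2⁻¹ : ℝ) • (x + y)) ≤ (g x + g y) / 2

/-- `g` is Jensen concave on the (convex) set `D`. -/
def JensenConcaveOn {X : Type*} [AddCommGroup X] [Module ℝ X] (D : Set X) (g : X → ℝ) : Prop :=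
  ∀ x ∈ D, ∀ y ∈ D, (g x + g y) / 2 ≤ g ((2⁻¹ : ℝ) • (x + y))

/-- The pointwise supremum, in `[-∞, +∞]`, of the functions in `S` lying below `F` on `D`
(equal to `-∞` if there is none). -/
def lowerEnvelope {α : Type*} (D : Set α) (S : Set (α → ℝ)) (F : α → ℝ) (x : α) : EReal :=
  sSup {y : EReal | ∃ g ∈ S, (∀ z ∈ D, g z ≤ F z) ∧ y = (g x : EReal)}

/-- The pointwise infimum, in `[-∞, +∞]`, of the functions in `S` lying above `F` on `D`
(equal to `+∞` if there is none). -/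
def upperEnvelope {α : Type*} (D : Set α) (S : Set (α → ℝ)) (F : α → ℝ) (x : α) : EReal :=
  sInf {y : EReal | ∃ g ∈ S, (∀ z ∈ D, F z ≤ g z) ∧ y = (g x : EReal)}

/-- The Jensen convex envelope of `φ : I → ℝ` within the continuous functions on `I`. -/
def convexEnvelopeC (I : Set ℝ) (φ : ℝ → ℝ) : ℝ → EReal :=
  lowerEnvelope I {g | ContinuousOn g I ∧ JensenConvexOn I g} φ

/-! ### Means of an arbitrary number of variables -/

/-- Finite tuples of real numbers of arbitrary length. -/
abbrev Tuple : Type := Σ n : ℕ, (Fin n → ℝ)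

/-- The cube `I ^ n`. -/
def cube (I : Set ℝ) (n : ℕ) : Set (Fin n → ℝ) := {a | ∀ i, a i ∈ I}

/-- The union of `I ^ n` over all `n ≥ 1`. -/
def tuples (I : Set ℝ) : Set Tuple := {p | 1 ≤ p.1 ∧ p.2 ∈ cube I p.1}

/-- The arithmetic mean. -/
def arithMean (p : Tuple) : ℝ := (∑ i, p.2 i) / (p.1 : ℝ)

/-- The quasiarithmetic mean generated by `f` on `I`, with the inverse `f⁻¹ : f(I) → I`. -/
def qaMean (I : Set ℝ) (f : ℝ → ℝ) (p : Tuple) : ℝ :=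
  Function.invFunOn f I ((∑ i, f (p.2 i)) / (p.1 : ℝ))

/-- The family of all quasiarithmetic means on `I`. -/
def quasiarithmeticMeans (I : Set ℝ) : Set (Tuple → ℝ) :=
  {M | ∃ h : ℝ → ℝ, ContinuousOn h I ∧ (StrictMonoOn h I ∨ StrictAntiOn h I) ∧
    ∀ p ∈ tuples I, M p = qaMean I h p}

/-- A mean on `I` is Jensen concave if, for every `n ≥ 1`, it is so as a function on `I ^ n`. -/
def IsJensenConcaveMean (I : Set ℝ) (M : Tuple → ℝ) : Prop :=
  ∀ n : ℕ, 1 ≤ n → JensenConcaveOn (cube I n) (fun a => M ⟨n, a⟩)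

/-- The Jensen concave envelope of a mean within the family of quasiarithmetic means on `I`. -/
def concaveEnvelopeQ (I : Set ℝ) (M : Tuple → ℝ) : Tuple → EReal :=
  upperEnvelope (tuples I) {N | N ∈ quasiarithmeticMeans I ∧ IsJensenConcaveMean I N} M

/-! ### Generators of class `C²` -/

/-- The first derivative on `I` (one-sided at endpoints belonging to `I`). -/
def deriv1 (I : Set ℝ) (f : ℝ → ℝ) : ℝ → ℝ := derivWithin f I

/-- The second derivative on `I` (one-sided at endpoints belonging to `I`). -/
def deriv2 (I : Set ℝ) (f : ℝ → ℝ) : ℝ → ℝ := derivWithin (derivWithin f I) I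

/-- `f` is twice continuously differentiable on `I` and `f'` vanishes nowhere on `I`. -/
def IsC2Sharp (I : Set ℝ) (f : ℝ → ℝ) : Prop :=
  ContDiffOn ℝ 2 f I ∧ ∀ x ∈ I, deriv1 I f x ≠ 0

end QAMeans

end

namespace QAMeans

open Set Filter Topology

/-! ### Passing from the interior of an interval to the whole interval -/

section Intervals

/-! An increasing generator `h` acts only through `h''/h'`, and two criteria drive the proof.
Comparison: the mean of `f` lies below that of `h` iff `f''/f' ≤ h''/h'` (`qaMean_le_qaMean`,
`deriv_mul_le_of_qaMean_le`). Concavity: if `-h'/h''` is positive and concave, the mean is Jensen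
concave (`isJensenConcaveMean_of_concaveOn`); conversely, Jensen concavity forces this or `h'' = 0`
in the interior (`exists_deriv_of_mean2JensenConcave`).

So a competitor above the mean of `f` is either affine or has `h'/h''` negative, convex and below
`f'/f''`. The smallest mean corresponds to the largest such quotient, the convex envelope `ψ` of
`f'/f''`, and `g` is found by integrating `g''/g' = 1/ψ`. If `f''` has a zero or no convex minorant
exists, only affine competitors remain, and the envelope is the arithmetic mean.

The hard point is that competitors are merely continuous. Concavity of the two-variable mean makes
`h` concave, then differentiable (`exists_hasDerivAt_of_mean2`). The tangent inequality for the mean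
then says that `(a, b) ↦ q a * (k b - k a)`, with `k = h⁻¹` and `q = h' ∘ k`, is jointly convex.
This makes `q` continuously differentiable, hence `h` twice so, and `kernel_three_point` extracts
the second-order condition without assuming that `q''` exists. All this happens in the interior;
endpoints are reached by continuity. -/

theorem nonempty_interior_of_nontrivial {I : Set ℝ} (hI : I.OrdConnected) (hI' : I.Nontrivial) :
    (interior I).Nonempty := by
  obtain ⟨a, ha, b, hb, hab⟩ := hI'.exists_lt
  exact (nonempty_Ioo.2 hab).mono
    (interior_maximal (Ioo_subset_Icc_self.trans (hI.out ha hb)) isOpen_Ioo)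

theorem mem_interior_of_lt_lt {I : Set ℝ} (hI : I.OrdConnected) {a b x : ℝ} (ha : a ∈ I)
    (hb : b ∈ I) (hax : a < x) (hxb : x < b) : x ∈ interior I :=
  interior_maximal (Ioo_subset_Icc_self.trans (hI.out ha hb)) isOpen_Ioo ⟨hax, hxb⟩

theorem subset_closure_interior {I : Set ℝ} (hI : I.OrdConnected) (hI' : I.Nontrivial) :
    I ⊆ closure (interior I) := by
  rw [Convex.closure_interior_eq_closure_of_nonempty_interior (𝕜 := ℝ) hI.convex
    (nonempty_interior_of_nontrivial hI hI')]
  exact subset_closure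

/-- An inequality between continuous functions on a nondegenerate interval extends from the
interior to the whole interval. -/
theorem le_on_of_le_on_interior {I : Set ℝ} (hI : I.OrdConnected) (hI' : I.Nontrivial)
    {u v : ℝ → ℝ} (hu : ContinuousOn u I) (hv : ContinuousOn v I)
    (h : ∀ x ∈ interior I, u x ≤ v x) : ∀ x ∈ I, u x ≤ v x := by
  intro x hx
  have hmem := subset_closure_interior hI hI' hx
  have := mem_closure_iff_nhdsWithin_neBot.1 hmem
  exact le_of_tendsto_of_tendsto ((hu x hx).mono interior_subset)
    ((hv x hx).mono interior_subset) (eventually_nhdsWithin_of_forall h)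

end Intervals

/-! ### Continuous midpoint convex functions are convex -/

section Jensen

/-- At the leftmost point of a positive maximum, the midpoint inequality on a symmetric pair around
it forces the maximum to be attained further left. -/
theorem le_zero_of_midpoint_le {a b : ℝ} (hab : a < b) {D : ℝ → ℝ}
    (hD : ContinuousOn D (Icc a b)) (ha : D a = 0) (hb : D b = 0)
    (hJ : ∀ x ∈ Icc a b, ∀ y ∈ Icc a b, D ((x + y) / 2) ≤ (D x + D y) / 2) :
    ∀ x ∈ Icc a b, D x ≤ 0 := by
  by_contra! hcon
  obtain ⟨w, hw, hDw⟩ := hcon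
  obtain ⟨c, hc, hmax⟩ := isCompact_Icc.exists_isMaxOn (nonempty_Icc.2 hab.le) hD
  have hcpos : 0 < D c := hDw.trans_le (hmax hw)
  set S := Icc a b ∩ D ⁻¹' {D c} with hS
  have hScomp : IsCompact S :=
    isCompact_Icc.of_isClosed_subset (hD.preimage_isClosed_of_isClosed isClosed_Icc
      isClosed_singleton) inter_subset_left
  have hSne : S.Nonempty := ⟨c, hc, rfl⟩
  obtain ⟨⟨h1, h2⟩, h3⟩ := hScomp.sInf_mem hSne
  set z := sInf S
  have h3' : D z = D c := h3
  have hza : a < z := lt_of_le_of_ne h1 (by rintro h; rw [← h, ha] at h3'; linarith)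
  have hzb : z < b := lt_of_le_of_ne h2 (by rintro h; rw [h, hb] at h3'; linarith)
  set δ := min (z - a) (b - z)
  have hδ : 0 < δ := lt_min (by linarith) (by linarith)
  have hδ1 : δ ≤ z - a := min_le_left _ _
  have hδ2 : δ ≤ b - z := min_le_right _ _
  have hm1 : z - δ ∈ Icc a b := ⟨by linarith, by linarith⟩
  have hm2 : z + δ ∈ Icc a b := ⟨by linarith, by linarith⟩
  have key := hJ _ hm1 _ hm2
  rw [show (z - δ + (z + δ)) / 2 = z by ring] at key
  have e1 : D (z - δ) ≤ D c := hmax hm1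
  have e2 : D (z + δ) ≤ D c := hmax hm2
  have : z - δ ∈ S := ⟨hm1, by simp only [mem_preimage, mem_singleton_iff]; linarith⟩
  have := csInf_le hScomp.bddBelow this
  change z ≤ z - δ at this
  linarith

/-- Continuous midpoint convex functions of a real variable are convex. -/
theorem convexOn_of_midpoint {s : Set ℝ} (hs : Convex ℝ s) {g : ℝ → ℝ} (hg : ContinuousOn g s)
    (hJ : ∀ x ∈ s, ∀ y ∈ s, g ((x + y) / 2) ≤ (g x + g y) / 2) : ConvexOn ℝ s g := by
  refine convexOn_of_slope_mono_adjacent hs fun {x y z} hx hz hxy hyz => ?_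
  have hxz := hxy.trans hyz
  have hsub : Icc x z ⊆ s := hs.ordConnected.out hx hz
  -- Subtracting the chord over `[x, z]` keeps the midpoint inequality and makes both end values
  -- zero.
  have h := le_zero_of_midpoint_le hxz (D := fun t => g t - (g x + (g z - g x) / (z - x) * (t - x)))
    ((hg.mono hsub).sub (by fun_prop)) (by simp)
    (by have : z - x ≠ 0 := by linarith
        field_simp; ring)
    (fun p hp q hq => by
      have := hJ p (hsub hp) q (hsub hq)
      have e : (g z - g x) / (z - x) * ((p + q) / 2 - x) =
        ((g z - g x) / (z - x) * (p - x) + (g z - g x) / (z - x) * (q - x)) / 2 := by ring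
      linarith) y ⟨hxy.le, hyz.le⟩
  have h' : g y ≤ g x + (g z - g x) / (z - x) * (y - x) := by linarith
  have p1 : 0 < y - x := by linarith
  have p2 : 0 < z - y := by linarith
  have p3 : 0 < z - x := by linarith
  rw [div_le_div_iff₀ p1 p2]
  have h2 : (g y - g x) * (z - x) ≤ (g z - g x) * (y - x) := by
    have := mul_le_mul_of_nonneg_right h' p3.le
    have e : (g x + (g z - g x) / (z - x) * (y - x)) * (z - x) =
      g x * (z - x) + (g z - g x) * (y - x) := by field_simp
    linarith
  linarith

theorem JensenConvexOn.convexOn {I : Set ℝ} (hI : I.OrdConnected) {g : ℝ → ℝ}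
    (hg : ContinuousOn g I) (hJ : JensenConvexOn I g) : ConvexOn ℝ I g :=
  convexOn_of_midpoint hI.convex hg fun x hx y hy => by
    have := hJ x hx y hy
    rwa [smul_eq_mul, inv_mul_eq_div] at this

theorem jensenConvexOn_of_convexOn {X : Type*} [AddCommGroup X] [Module ℝ X] {D : Set X}
    {g : X → ℝ} (h : ConvexOn ℝ D g) : JensenConvexOn D g := fun x hx y hy => by
  have := h.2 hx hy (by norm_num : (0 : ℝ) ≤ 2⁻¹) (by norm_num : (0 : ℝ) ≤ 2⁻¹) (by norm_num)
  rw [smul_add]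
  simp only [smul_eq_mul] at this
  linarith

theorem concaveOn_of_midpoint {s : Set ℝ} (hs : Convex ℝ s) {g : ℝ → ℝ} (hg : ContinuousOn g s)
    (hJ : ∀ x ∈ s, ∀ y ∈ s, (g x + g y) / 2 ≤ g ((x + y) / 2)) : ConcaveOn ℝ s g := by
  rw [← neg_convexOn_iff]
  refine convexOn_of_midpoint hs hg.neg fun x hx y hy => ?_
  have := hJ x hx y hy
  simp only [Pi.neg_apply]
  linarith

end Jensen

/-! ### Continuity and derivatives of inverse functions on intervals -/

section Inverse

variable {I : Set ℝ} {h : ℝ → ℝ}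

theorem ordConnected_image (hI : I.OrdConnected) (hc : ContinuousOn h I) :
    (h '' I).OrdConnected :=
  (hI.isPreconnected.image h hc).ordConnected

theorem invFunOn_mem_of_image {y : ℝ} (hy : y ∈ h '' I) : Function.invFunOn h I y ∈ I :=
  Function.invFunOn_mem hy

theorem apply_invFunOn {y : ℝ} (hy : y ∈ h '' I) : h (Function.invFunOn h I y) = y :=
  Function.invFunOn_eq hy

theorem invFunOn_apply (hinj : InjOn h I) {x : ℝ} (hx : x ∈ I) :
    Function.invFunOn h I (h x) = x :=
  hinj (invFunOn_mem_of_image (mem_image_of_mem h hx)) hx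
    (apply_invFunOn (mem_image_of_mem h hx))

theorem strictMonoOn_invFunOn (hm : StrictMonoOn h I) :
    StrictMonoOn (Function.invFunOn h I) (h '' I) := by
  rintro _ ⟨x, hx, rfl⟩ _ ⟨y, hy, rfl⟩ hxy
  rw [invFunOn_apply hm.injOn hx, invFunOn_apply hm.injOn hy]
  exact (hm.lt_iff_lt hx hy).1 hxy

theorem continuousOn_invFunOn (hI : I.OrdConnected) (hc : ContinuousOn h I)
    (hm : StrictMonoOn h I) : ContinuousOn (Function.invFunOn h I) (h '' I) := by
  have := hI
  have := ordConnected_image hI hc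
  rw [continuousOn_iff_continuous_domRestrict]
  have key : (h '' I).domRestrict (Function.invFunOn h I) =
      fun y => ((hm.orderIso h I).symm y : ℝ) := by
    ext ⟨y, hy⟩
    obtain ⟨x, hx, rfl⟩ := hy
    change Function.invFunOn h I (h x) = _
    rw [invFunOn_apply hm.injOn hx]
    have : (hm.orderIso h I).symm (hm.orderIso h I ⟨x, hx⟩) = ⟨x, hx⟩ :=
      OrderIso.symm_apply_apply _ _
    exact (congrArg Subtype.val this).symm
  rw [key]
  exact continuous_subtype_val.comp (hm.orderIso h I).symm.continuous

/-- Differentiation of an implicitly given function: if `h ∘ m = G` near `t`, then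
`m' = G' / h'`. -/
theorem hasDerivAt_of_comp_eq {m G : ℝ → ℝ} {t h' G' : ℝ} (hmc : ContinuousAt m t)
    (hmI : ∀ᶠ s in 𝓝 t, m s ∈ I) (hcomp : ∀ᶠ s in 𝓝 t, h (m s) = G s)
    (hh : HasDerivWithinAt h h' I (m t)) (h0 : h' ≠ 0) (hG : HasDerivAt G G' t) :
    HasDerivAt m (G' / h') t := by
  rw [← hasDerivWithinAt_univ] at hG ⊢
  have := HasFDerivWithinAt.of_comp_of_leftInverse (g := m) (f := h) (h := G) (s := univ) (t := I)
    (a := t) (f'symm := ContinuousLinearMap.toSpanSingleton ℝ (h'⁻¹))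
    (by
      rw [nhdsWithin_univ]
      exact tendsto_nhdsWithin_iff.2 ⟨hmc, hmI⟩)
    hh.hasFDerivWithinAt hG.hasFDerivWithinAt (by rw [nhdsWithin_univ]; exact hcomp)
    (fun x => by simp [h0]) (mem_univ _)
  have := this.hasDerivWithinAt
  simpa [div_eq_mul_inv] using this

theorem mem_interior_image (hI : I.OrdConnected) (hc : ContinuousOn h I)
    (hm : StrictMonoOn h I) {x : ℝ} (hx : x ∈ interior I) : h x ∈ interior (h '' I) := by
  obtain ⟨a, b, hab, hsub⟩ := mem_nhds_iff_exists_Ioo_subset.1 (mem_interior_iff_mem_nhds.1 hx)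
  obtain ⟨c, hac, hcx⟩ := exists_between hab.1
  obtain ⟨d, hxd, hdb⟩ := exists_between hab.2
  have hcI : c ∈ I := hsub ⟨hac, hcx.trans hab.2⟩
  have hdI : d ∈ I := hsub ⟨hab.1.trans hxd, hdb⟩
  exact mem_interior_of_lt_lt (ordConnected_image hI hc) (mem_image_of_mem h hcI)
    (mem_image_of_mem h hdI) (hm hcI (interior_subset hx) hcx) (hm (interior_subset hx) hdI hxd)

end Inverse

/-! ### Basic properties of quasiarithmetic means -/

section Means

variable {I : Set ℝ} {h : ℝ → ℝ}

theorem avg_mem {s : Set ℝ} (hs : s.OrdConnected) {n : ℕ} (hn : 1 ≤ n) {a : Fin n → ℝ}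
    (ha : ∀ i, a i ∈ s) : (∑ i, a i) / (n : ℝ) ∈ s := by
  have hn' : (n : ℝ) ≠ 0 := by positivity
  have := hs.convex.sum_mem (t := Finset.univ) (w := fun _ : Fin n => (n : ℝ)⁻¹) (z := a)
    (fun _ _ => by positivity) (by simp [hn']) (fun i _ => ha i)
  rwa [← Finset.smul_sum, smul_eq_mul, inv_mul_eq_div] at this

theorem avg_mem_image (hI : I.OrdConnected) (hc : ContinuousOn h I) {p : Tuple}
    (hp : p ∈ tuples I) : (∑ i, h (p.2 i)) / (p.1 : ℝ) ∈ h '' I :=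
  avg_mem (ordConnected_image hI hc) hp.1 fun i => mem_image_of_mem h (hp.2 i)

theorem qaMean_mem (hI : I.OrdConnected) (hc : ContinuousOn h I) {p : Tuple}
    (hp : p ∈ tuples I) : qaMean I h p ∈ I :=
  invFunOn_mem_of_image (avg_mem_image hI hc hp)

theorem apply_qaMean (hI : I.OrdConnected) (hc : ContinuousOn h I) {p : Tuple}
    (hp : p ∈ tuples I) : h (qaMean I h p) = (∑ i, h (p.2 i)) / (p.1 : ℝ) :=
  apply_invFunOn (avg_mem_image hI hc hp)

theorem qaMean_eq (hinj : InjOn h I) {p : Tuple} {m : ℝ} (hm : m ∈ I)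
    (h' : h m = (∑ i, h (p.2 i)) / (p.1 : ℝ)) : qaMean I h p = m := by
  rw [qaMean, ← h', invFunOn_apply hinj hm]

theorem qaMean_neg (hI : I.OrdConnected) (hc : ContinuousOn h I) (hinj : InjOn h I) {p : Tuple}
    (hp : p ∈ tuples I) : qaMean I (fun x => -h x) p = qaMean I h p := by
  refine qaMean_eq (fun x hx y hy hxy => hinj hx hy (neg_injective hxy)) (qaMean_mem hI hc hp) ?_
  rw [apply_qaMean hI hc hp, Finset.sum_neg_distrib, neg_div]

theorem qaMean_id (hI : I.OrdConnected) {p : Tuple} (hp : p ∈ tuples I) :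
    qaMean I (fun x => x) p = arithMean p :=
  qaMean_eq (fun _ _ _ _ h => h) (avg_mem hI hp.1 hp.2) rfl

end Means

/-! ### Means of two variables -/

section Pairs

variable {I : Set ℝ} {h : ℝ → ℝ}

theorem pair_mem_tuples {x y : ℝ} (hx : x ∈ I) (hy : y ∈ I) :
    (⟨2, ![x, y]⟩ : Tuple) ∈ tuples I :=
  ⟨by norm_num, fun i => by fin_cases i <;> simpa⟩

/-- The two-variable quasiarithmetic mean generated by `h` on `I`. -/
noncomputable def mean2 (I : Set ℝ) (h : ℝ → ℝ) (x y : ℝ) : ℝ := qaMean I h ⟨2, ![x, y]⟩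

theorem mean2_mem (hI : I.OrdConnected) (hc : ContinuousOn h I) {x y : ℝ} (hx : x ∈ I)
    (hy : y ∈ I) : mean2 I h x y ∈ I :=
  qaMean_mem hI hc (pair_mem_tuples hx hy)

theorem apply_mean2 (hI : I.OrdConnected) (hc : ContinuousOn h I) {x y : ℝ} (hx : x ∈ I)
    (hy : y ∈ I) : h (mean2 I h x y) = (h x + h y) / 2 := by
  have := apply_qaMean hI hc (pair_mem_tuples hx hy)
  rw [mean2, this]
  simp

end Pairs

/-! ### Comparing two quasiarithmetic means -/

section Comparison

variable {I : Set ℝ} {h : ℝ → ℝ}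

theorem hasDerivAt_invFunOn (hI : I.OrdConnected) (hc : ContinuousOn h I)
    (hm : StrictMonoOn h I) {x h' : ℝ} (hx : x ∈ interior I) (hh : HasDerivAt h h' x)
    (h0 : h' ≠ 0) : HasDerivAt (Function.invFunOn h I) (1 / h') (h x) := by
  have hn : h '' I ∈ 𝓝 (h x) := mem_interior_iff_mem_nhds.1 (mem_interior_image hI hc hm hx)
  have e := invFunOn_apply hm.injOn (interior_subset hx)
  refine hasDerivAt_of_comp_eq (I := I) (h := h) (G := fun y => y)
    ((continuousOn_invFunOn hI hc hm).continuousAt hn) ?_ ?_ ?_ h0 (hasDerivAt_id _)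
  · filter_upwards [hn] with y hy using invFunOn_mem_of_image hy
  · filter_upwards [hn] with y hy using apply_invFunOn hy
  · rw [e]
    exact hh.hasDerivWithinAt

/-- A quasiarithmetic mean is in the interior unless all entries coincide. -/
theorem eq_qaMean_or_mem_interior (hI : I.OrdConnected) (hc : ContinuousOn h I)
    (hm : StrictMonoOn h I) {p : Tuple} (hp : p ∈ tuples I) :
    (∀ i, p.2 i = qaMean I h p) ∨ qaMean I h p ∈ interior I := by
  have hmem := qaMean_mem hI hc hp
  have happ := apply_qaMean hI hc hp
  have hn : (p.1 : ℝ) ≠ 0 := by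
    have := hp.1
    positivity
  set m := qaMean I h p
  have hsum : ∑ i, h (p.2 i) = ∑ _i : Fin p.1, h m := by
    rw [happ]
    simp
    field_simp
  by_cases h1 : ∀ i, m ≤ p.2 i
  · left
    have := (Finset.sum_eq_sum_iff_of_le (s := Finset.univ) (f := fun _ : Fin p.1 => h m)
      (g := fun i => h (p.2 i)) fun i _ => hm.monotoneOn hmem (hp.2 i) (h1 i)).1 hsum.symm
    exact fun i => (hm.injOn hmem (hp.2 i) (this i (Finset.mem_univ i))).symm
  by_cases h2 : ∀ i, p.2 i ≤ m
  · left
    have := (Finset.sum_eq_sum_iff_of_le (s := Finset.univ) (g := fun _ : Fin p.1 => h m)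
      (f := fun i => h (p.2 i)) fun i _ => hm.monotoneOn (hp.2 i) hmem (h2 i)).1 hsum
    exact fun i => hm.injOn (hp.2 i) hmem (this i (Finset.mem_univ i))
  push Not at h1 h2
  obtain ⟨i, hi⟩ := h1
  obtain ⟨j, hj⟩ := h2
  exact Or.inr (mem_interior_of_lt_lt hI (hp.2 i) (hp.2 j) hi hj)

theorem avg_le_avg {n : ℕ} {a b : Fin n → ℝ} (h : ∀ i, a i ≤ b i) :
    (∑ i, a i) / (n : ℝ) ≤ (∑ i, b i) / (n : ℝ) :=
  div_le_div_of_nonneg_right (Finset.sum_le_sum fun i _ => h i) (Nat.cast_nonneg n)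

theorem monotoneOn_of_hasDerivAt_nonneg {s : Set ℝ} (hs : s.OrdConnected) {φ φ' : ℝ → ℝ}
    (hc : ContinuousOn φ s) (hd : ∀ x ∈ interior s, HasDerivAt φ (φ' x) x)
    (h0 : ∀ x ∈ interior s, 0 ≤ φ' x) : MonotoneOn φ s :=
  monotoneOn_of_deriv_nonneg hs.convex hc
    (fun x hx => (hd x hx).differentiableAt.differentiableWithinAt)
    fun x hx => (hd x hx).deriv ▸ h0 x hx

theorem strictMonoOn_of_hasDerivAt_pos {s : Set ℝ} (hs : s.OrdConnected) {φ φ' : ℝ → ℝ}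
    (hc : ContinuousOn φ s) (hd : ∀ x ∈ interior s, HasDerivAt φ (φ' x) x)
    (h0 : ∀ x ∈ interior s, 0 < φ' x) : StrictMonoOn φ s :=
  strictMonoOn_of_deriv_pos hs.convex hc fun x hx => (hd x hx).deriv ▸ h0 x hx

theorem antitoneOn_of_hasDerivAt_nonpos {s : Set ℝ} (hs : s.OrdConnected) {φ φ' : ℝ → ℝ}
    (hc : ContinuousOn φ s) (hd : ∀ x ∈ interior s, HasDerivAt φ (φ' x) x)
    (h0 : ∀ x ∈ interior s, φ' x ≤ 0) : AntitoneOn φ s :=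
  antitoneOn_of_deriv_nonpos hs.convex hc
    (fun x hx => (hd x hx).differentiableAt.differentiableWithinAt)
    fun x hx => (hd x hx).deriv ▸ h0 x hx

theorem hasDerivAt_div_of_pos {d₁ d₂ : ℝ → ℝ} {e₁ e₂ x : ℝ} (h₁ : HasDerivAt d₁ e₁ x)
    (h₂ : HasDerivAt d₂ e₂ x) (hpos : 0 < d₁ x) :
    HasDerivAt (fun t => d₂ t / d₁ t) ((e₂ * d₁ x - d₂ x * e₁) / d₁ x ^ 2) x :=
  h₂.div h₁ hpos.ne'

theorem monotoneOn_div_of_hasDerivAt (hI : I.OrdConnected) {d₁ d₂ e₁ e₂ : ℝ → ℝ}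
    (he₁ : ∀ x ∈ interior I, HasDerivAt d₁ (e₁ x) x)
    (he₂ : ∀ x ∈ interior I, HasDerivAt d₂ (e₂ x) x)
    (hp₁ : ∀ x ∈ interior I, 0 < d₁ x)
    (hle : ∀ x ∈ interior I, e₁ x * d₂ x ≤ e₂ x * d₁ x) :
    MonotoneOn (fun x => d₂ x / d₁ x) (interior I) := by
  have hd := fun x hx => hasDerivAt_div_of_pos (he₁ x hx) (he₂ x hx) (hp₁ x hx)
  refine monotoneOn_of_hasDerivAt_nonneg hI.convex.interior.ordConnected
    (fun x hx => (hd x hx).continuousAt.continuousWithinAt) (φ' := fun x => _)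
    (fun x hx => hd x (interior_subset hx)) fun x hx => ?_
  have := hle x (interior_subset hx)
  exact div_nonneg (by linarith) (sq_nonneg _)

/-- Comparison of quasiarithmetic means through `h'' / h'`. -/
theorem qaMean_le_qaMean (hI : I.OrdConnected) {h₁ h₂ d₁ d₂ e₁ e₂ : ℝ → ℝ}
    (hc₁ : ContinuousOn h₁ I) (hc₂ : ContinuousOn h₂ I)
    (hm₁ : StrictMonoOn h₁ I) (hm₂ : StrictMonoOn h₂ I)
    (hd₁ : ∀ x ∈ interior I, HasDerivAt h₁ (d₁ x) x)
    (hd₂ : ∀ x ∈ interior I, HasDerivAt h₂ (d₂ x) x)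
    (he₁ : ∀ x ∈ interior I, HasDerivAt d₁ (e₁ x) x)
    (he₂ : ∀ x ∈ interior I, HasDerivAt d₂ (e₂ x) x)
    (hp₁ : ∀ x ∈ interior I, 0 < d₁ x)
    (hle : ∀ x ∈ interior I, e₁ x * d₂ x ≤ e₂ x * d₁ x) {p : Tuple} (hp : p ∈ tuples I) :
    qaMean I h₁ p ≤ qaMean I h₂ p := by
  have hmem := qaMean_mem hI hc₁ hp
  have hmem₂ := qaMean_mem hI hc₂ hp
  have hn : (p.1 : ℝ) ≠ 0 := by
    have := hp.1
    positivity
  rw [← hm₂.le_iff_le hmem hmem₂, apply_qaMean hI hc₂ hp]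
  have happ := apply_qaMean hI hc₁ hp
  have hcases := eq_qaMean_or_mem_interior hI hc₁ hm₁ hp
  set m := qaMean I h₁ p
  -- Derivatives are available only in the interior; a mean sitting at an endpoint falls under the
  -- first, trivial alternative.
  rcases hcases with hall | hint
  · simp only [hall]
    simp
    field_simp
    exact le_rfl
  have hmono := monotoneOn_div_of_hasDerivAt hI he₁ he₂ hp₁ hle
  -- This slope makes `m` critical for `h₂ - c * h₁`, and monotonicity of `d₂ / d₁` makes it a
  -- global minimum. Averaging the resulting inequality over the entries cancels the `h₁` terms,
  -- since `h₁ m` is the average of `h₁`.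
  set c := d₂ m / d₁ m with hcdef
  have hφc : ContinuousOn (fun x => h₂ x - c * h₁ x) I := hc₂.sub (continuousOn_const.mul hc₁)
  have hφd : ∀ x ∈ interior I, HasDerivAt (fun x => h₂ x - c * h₁ x) (d₂ x - c * d₁ x) x :=
    fun x hx => (hd₂ x hx).sub ((hd₁ x hx).const_mul c)
  have hR : MonotoneOn (fun x => h₂ x - c * h₁ x) (I ∩ Ici m) := by
    refine monotoneOn_of_hasDerivAt_nonneg (hI.inter ordConnected_Ici)
      (hφc.mono inter_subset_left)
      (fun x hx => hφd x (interior_mono inter_subset_left hx)) fun x hx => ?_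
    have hxI := interior_mono inter_subset_left hx
    have hxm : m ≤ x := (interior_subset hx).2
    have := hmono hint hxI hxm
    have h1 := hp₁ x hxI
    have : c * d₁ x ≤ d₂ x := (le_div_iff₀ h1).1 this
    linarith
  have hL : AntitoneOn (fun x => h₂ x - c * h₁ x) (I ∩ Iic m) := by
    refine antitoneOn_of_hasDerivAt_nonpos (hI.inter ordConnected_Iic)
      (hφc.mono inter_subset_left)
      (fun x hx => hφd x (interior_mono inter_subset_left hx)) fun x hx => ?_
    have hxI := interior_mono inter_subset_left hx
    have hxm : x ≤ m := (interior_subset hx).2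
    have := hmono hxI hint hxm
    have h1 := hp₁ x hxI
    have : d₂ x ≤ c * d₁ x := (div_le_iff₀ h1).1 this
    linarith
  have hmin : ∀ x ∈ I, h₂ m - c * h₁ m ≤ h₂ x - c * h₁ x := by
    intro x hx
    rcases le_total m x with hmx | hmx
    · exact hR ⟨hmem, self_mem_Ici⟩ ⟨hx, hmx⟩ hmx
    · exact hL ⟨hx, hmx⟩ ⟨hmem, self_mem_Iic⟩ hmx
  have := avg_le_avg (n := p.1) (a := fun _ => h₂ m - c * h₁ m)
    (b := fun i => h₂ (p.2 i) - c * h₁ (p.2 i)) fun i => hmin _ (hp.2 i)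
  simp only [Finset.sum_sub_distrib, ← Finset.mul_sum, sub_div, mul_div_assoc, Finset.sum_const,
    Finset.card_univ, Fintype.card_fin, nsmul_eq_mul] at this
  rw [← happ] at this
  have e : ∀ z : ℝ, (p.1 : ℝ) * (z / p.1) = z := fun z => mul_div_cancel₀ z hn
  simp only [e] at this
  linarith

/-- Necessity in the comparison of quasiarithmetic means through `h'' / h'`. -/
theorem deriv_mul_le_of_qaMean_le (hI : I.OrdConnected) {h₁ h₂ d₁ d₂ e₁ e₂ : ℝ → ℝ}
    (hc₁ : ContinuousOn h₁ I) (hc₂ : ContinuousOn h₂ I)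
    (hm₁ : StrictMonoOn h₁ I) (hm₂ : StrictMonoOn h₂ I)
    (hd₁ : ∀ x ∈ interior I, HasDerivAt h₁ (d₁ x) x)
    (hd₂ : ∀ x ∈ interior I, HasDerivAt h₂ (d₂ x) x)
    (he₁ : ∀ x ∈ interior I, HasDerivAt d₁ (e₁ x) x)
    (he₂ : ∀ x ∈ interior I, HasDerivAt d₂ (e₂ x) x)
    (hp₁ : ∀ x ∈ interior I, 0 < d₁ x)
    (hle : ∀ p ∈ tuples I, qaMean I h₁ p ≤ qaMean I h₂ p) :
    ∀ x ∈ interior I, e₁ x * d₂ x ≤ e₂ x * d₁ x := by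
  have hmaps : MapsTo (Function.invFunOn h₁ I) (h₁ '' I) I := fun y hy => invFunOn_mem_of_image hy
  -- On pairs, the comparison of the means is midpoint convexity of `h₂ ∘ h₁⁻¹`, whose derivative at
  -- `h₁ x` is `d₂ x / d₁ x`.
  have hconv : ConvexOn ℝ (h₁ '' I) (h₂ ∘ Function.invFunOn h₁ I) := by
    refine convexOn_of_midpoint (ordConnected_image hI hc₁).convex
      (hc₂.comp (continuousOn_invFunOn hI hc₁ hm₁) hmaps) ?_
    rintro _ ⟨x, hx, rfl⟩ _ ⟨y, hy, rfl⟩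
    simp only [Function.comp_apply]
    rw [← apply_mean2 hI hc₁ hx hy, invFunOn_apply hm₁.injOn hx, invFunOn_apply hm₁.injOn hy,
      invFunOn_apply hm₁.injOn (mean2_mem hI hc₁ hx hy), ← apply_mean2 hI hc₂ hx hy]
    exact hm₂.monotoneOn (mean2_mem hI hc₁ hx hy) (mean2_mem hI hc₂ hx hy)
      (hle _ (pair_mem_tuples hx hy))
  have hder : ∀ x ∈ interior I,
      HasDerivAt (h₂ ∘ Function.invFunOn h₁ I) (d₂ x / d₁ x) (h₁ x) := by
    intro x hx
    have h1 := hasDerivAt_invFunOn hI hc₁ hm₁ hx (hd₁ x hx) (hp₁ x hx).ne'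
    have h2 := hd₂ x hx
    rw [← invFunOn_apply hm₁.injOn (interior_subset hx)] at h2
    have := h2.comp _ h1
    rwa [invFunOn_apply hm₁.injOn (interior_subset hx), mul_one_div] at this
  have hmono : MonotoneOn (fun x => d₂ x / d₁ x) (interior I) := by
    intro x hx y hy hxy
    rcases hxy.eq_or_lt with rfl | hlt
    · exact le_rfl
    have hxI := interior_subset hx
    have hyI := interior_subset hy
    exact (hconv.le_slope_of_hasDerivAt (mem_image_of_mem _ hxI) (mem_image_of_mem _ hyI)
      (hm₁ hxI hyI hlt) (hder x hx)).trans
      (hconv.slope_le_of_hasDerivAt (mem_image_of_mem _ hxI) (mem_image_of_mem _ hyI)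
      (hm₁ hxI hyI hlt) (hder y hy))
  intro x hx
  have h1 := hasDerivAt_div_of_pos (he₁ x hx) (he₂ x hx) (hp₁ x hx)
  have h2 := hmono.derivWithin_nonneg (x := x)
  rw [derivWithin_of_isOpen isOpen_interior hx, h1.deriv] at h2
  have hp := pow_pos (hp₁ x hx) 2
  have := (div_nonneg_iff.1 h2).resolve_right (fun h => absurd h.2 (not_le.2 hp))
  linarith [this.1]

end Comparison

/-! ### Concavity of the mean when `-g'/g''` is positive and concave -/

section Sufficiency

variable {I : Set ℝ} {g G U : ℝ → ℝ}

/-- With `L t = U x + σ * (t - x)`, the derivative simplifies to `G / U * (L - U)`, so its sign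
tells on which side of the line `U` lies. Only the line is differentiated, so `U` need not be
differentiable. -/
theorem hasDerivAt_chord_defect (hI : I.OrdConnected)
    (hg : ∀ x ∈ I, HasDerivWithinAt g (G x) I x)
    (hG : ∀ x ∈ I, HasDerivWithinAt G (-G x / U x) I x) {x y : ℝ} (hx : x ∈ I) (hy : y ∈ I)
    (σ : ℝ) :
    ContinuousOn (fun t => (σ - 1) * g t - G t * (U x + σ * (t - x))) (Icc x y) ∧
    ∀ t ∈ interior (Icc x y), HasDerivAt (fun t => (σ - 1) * g t - G t * (U x + σ * (t - x)))
      ((σ - 1) * G t - (-G t / U t * (U x + σ * (t - x)) + G t * (σ * 1))) t := by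
  have hsub := hI.out hx hy
  have hgc : ContinuousOn g (Icc x y) := fun t ht => (hg t (hsub ht)).continuousWithinAt.mono hsub
  have hGc : ContinuousOn G (Icc x y) := fun t ht => (hG t (hsub ht)).continuousWithinAt.mono hsub
  refine ⟨by fun_prop, fun t ht => ?_⟩
  rw [interior_Icc] at ht
  have hn : I ∈ 𝓝 t := mem_interior_iff_mem_nhds.1 (mem_interior_of_lt_lt hI hx hy ht.1 ht.2)
  have htI := mem_of_mem_nhds hn
  have h1 := ((hg t htI).hasDerivAt hn).const_mul (σ - 1)
  have h2 : HasDerivAt (fun t => U x + σ * (t - x)) (σ * 1) t :=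
    (((hasDerivAt_id t).sub_const x).const_mul σ).const_add (U x)
  exact h1.sub (((hG t htI).hasDerivAt hn).mul h2)

/-- For smooth `U` one has `d(G U)/dg = U' - 1`; this is the integrated form, with a line of slope
`σ` in place of `U`. -/
theorem weight_sub_le (hI : I.OrdConnected) (hg : ∀ x ∈ I, HasDerivWithinAt g (G x) I x)
    (hG : ∀ x ∈ I, HasDerivWithinAt G (-G x / U x) I x) (hGpos : ∀ x ∈ I, 0 < G x)
    (hUpos : ∀ x ∈ I, 0 < U x) {x y σ : ℝ} (hx : x ∈ I) (hy : y ∈ I) (hxy : x < y)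
    (hL : ∀ t ∈ Icc x y, U t ≤ U x + σ * (t - x)) :
    G y * U y - G x * U x ≤ (σ - 1) * (g y - g x) := by
  obtain ⟨hc, hd⟩ := hasDerivAt_chord_defect hI hg hG hx hy σ
  have hmono := monotoneOn_of_hasDerivAt_nonneg ordConnected_Icc hc hd fun t ht => by
    have htI := hI.out hx hy (interior_subset ht)
    have h1 := hGpos t htI
    have h2 := hUpos t htI
    have h3 := hL t (interior_subset ht)
    have : (σ - 1) * G t - (-G t / U t * (U x + σ * (t - x)) + G t * (σ * 1)) =
      G t / U t * (U x + σ * (t - x) - U t) := by field_simp; ring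
    rw [this]
    exact mul_nonneg (by positivity) (by linarith)
  have h1 := hmono (left_mem_Icc.2 hxy.le) (right_mem_Icc.2 hxy.le) hxy.le
  have h2 := mul_le_mul_of_nonneg_left (hL y (right_mem_Icc.2 hxy.le)) (hGpos y hy).le
  simp only [sub_self, mul_zero, add_zero] at h1
  linarith

theorem le_weight_sub (hI : I.OrdConnected) (hg : ∀ x ∈ I, HasDerivWithinAt g (G x) I x)
    (hG : ∀ x ∈ I, HasDerivWithinAt G (-G x / U x) I x) (hGpos : ∀ x ∈ I, 0 < G x)
    (hUpos : ∀ x ∈ I, 0 < U x) {x y σ : ℝ} (hx : x ∈ I) (hy : y ∈ I) (hxy : x < y)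
    (hL : ∀ t ∈ Icc x y, U x + σ * (t - x) ≤ U t) :
    (σ - 1) * (g y - g x) ≤ G y * U y - G x * U x := by
  obtain ⟨hc, hd⟩ := hasDerivAt_chord_defect hI hg hG hx hy σ
  have hmono := antitoneOn_of_hasDerivAt_nonpos ordConnected_Icc hc hd fun t ht => by
    have htI := hI.out hx hy (interior_subset ht)
    have h1 := hGpos t htI
    have h2 := hUpos t htI
    have h3 := hL t (interior_subset ht)
    have : (σ - 1) * G t - (-G t / U t * (U x + σ * (t - x)) + G t * (σ * 1)) =
      G t / U t * (U x + σ * (t - x) - U t) := by field_simp; ring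
    rw [this]
    exact mul_nonpos_of_nonneg_of_nonpos (by positivity) (by linarith)
  have h1 := hmono (left_mem_Icc.2 hxy.le) (right_mem_Icc.2 hxy.le) hxy.le
  have h2 := mul_le_mul_of_nonneg_left (hL y (right_mem_Icc.2 hxy.le)) (hGpos y hy).le
  simp only [sub_self, mul_zero, add_zero] at h1
  linarith

theorem strictMonoOn_of_hasDerivWithinAt_pos (hI : I.OrdConnected)
    (hg : ∀ x ∈ I, HasDerivWithinAt g (G x) I x) (hGpos : ∀ x ∈ I, 0 < G x) :
    StrictMonoOn g I :=
  strictMonoOn_of_hasDerivAt_pos hI (fun x hx => (hg x hx).continuousWithinAt)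
    (fun x hx => (hg x (interior_subset hx)).hasDerivAt (mem_interior_iff_mem_nhds.1 hx))
    fun x hx => hGpos x (interior_subset hx)

/-- If `U = -g' / g''` is concave and positive, then `g' U` is a concave function of `g`. -/
theorem concaveOn_weight (hI : I.OrdConnected) (hg : ∀ x ∈ I, HasDerivWithinAt g (G x) I x)
    (hG : ∀ x ∈ I, HasDerivWithinAt G (-G x / U x) I x) (hGpos : ∀ x ∈ I, 0 < G x)
    (hUpos : ∀ x ∈ I, 0 < U x) (hU : ConcaveOn ℝ I U) :
    ConcaveOn ℝ (g '' I) (fun a => G (Function.invFunOn g I a) * U (Function.invFunOn g I a)) := by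
  have hgc : ContinuousOn g I := fun x hx => (hg x hx).continuousWithinAt
  have hm := strictMonoOn_of_hasDerivWithinAt_pos hI hg hGpos
  refine concaveOn_of_slope_anti_adjacent (ordConnected_image hI hgc).convex ?_
  rintro a b c ha hc hab hbc
  obtain ⟨m, hmI, rfl⟩ := (ordConnected_image hI hgc).out ha hc ⟨hab.le, hbc.le⟩
  obtain ⟨x, hx, rfl⟩ := ha
  obtain ⟨y, hy, rfl⟩ := hc
  rw [invFunOn_apply hm.injOn hx, invFunOn_apply hm.injOn hy, invFunOn_apply hm.injOn hmI]
  have hxm := (hm.lt_iff_lt hx hmI).1 hab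
  have hmy := (hm.lt_iff_lt hmI hy).1 hbc
  -- By concavity `U` lies above this chord on `[x, m]` and below its extension on `[m, y]`, so `σ -
  -- 1` separates the two slopes of the weight.
  set σ := (U m - U x) / (m - x) with hσ
  have h1 := le_weight_sub hI hg hG hGpos hUpos hx hmI hxm (σ := σ) fun t ht => by
    rcases ht.1.eq_or_lt with rfl | hxt
    · simp
    rcases ht.2.eq_or_lt with rfl | htm
    · have : t - x ≠ 0 := by linarith
      rw [hσ, div_mul_cancel₀ _ this]
      linarith
    have s1 := hU.slope_anti_adjacent hx hmI hxt htm
    have p1 : 0 < t - x := by linarith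
    have p2 : 0 < m - t := by linarith
    have p3 : 0 < m - x := by linarith
    rw [div_le_div_iff₀ p2 p1] at s1
    have : σ * (t - x) ≤ U t - U x := by
      rw [hσ, div_mul_eq_mul_div, div_le_iff₀ p3]
      linarith
    linarith
  have h2 := weight_sub_le hI hg hG hGpos hUpos hmI hy hmy (σ := σ) fun t ht => by
    rcases ht.1.eq_or_lt with rfl | hmt
    · simp
    have s1 := hU.slope_anti_adjacent hx (hI.out hmI hy ht) hxm hmt
    have p1 : 0 < t - m := by linarith
    have := (div_le_iff₀ p1).1 s1
    linarith
  have q1 : 0 < g m - g x := by linarith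
  have q2 : 0 < g y - g m := by linarith
  exact ((div_le_iff₀ q2).2 h2).trans ((le_div_iff₀ q1).2 h1)

theorem avg_weight_le (hI : I.OrdConnected) (hg : ∀ x ∈ I, HasDerivWithinAt g (G x) I x)
    (hG : ∀ x ∈ I, HasDerivWithinAt G (-G x / U x) I x) (hGpos : ∀ x ∈ I, 0 < G x)
    (hUpos : ∀ x ∈ I, 0 < U x) (hU : ConcaveOn ℝ I U) {p : Tuple} (hp : p ∈ tuples I) :
    (∑ i, G (p.2 i) * U (p.2 i)) / (p.1 : ℝ) ≤ G (qaMean I g p) * U (qaMean I g p) := by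
  have hgc : ContinuousOn g I := fun x hx => (hg x hx).continuousWithinAt
  have hm := strictMonoOn_of_hasDerivWithinAt_pos hI hg hGpos
  have hn : (p.1 : ℝ) ≠ 0 := by
    have := hp.1
    positivity
  have := (concaveOn_weight hI hg hG hGpos hUpos hU).le_map_sum (t := Finset.univ)
    (w := fun _ : Fin p.1 => (p.1 : ℝ)⁻¹) (p := fun i => g (p.2 i))
    (fun _ _ => by positivity) (by simp [hn]) (fun i _ => mem_image_of_mem g (hp.2 i))
  rw [← Finset.smul_sum, ← Finset.smul_sum, smul_eq_mul, smul_eq_mul, inv_mul_eq_div,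
    inv_mul_eq_div, ← apply_qaMean hI hgc hp, invFunOn_apply hm.injOn (qaMean_mem hI hgc hp)]
    at this
  simpa only [invFunOn_apply hm.injOn (hp.2 _)] using this

/-- If `-g' / g''` is concave and positive, then the mean generated by `g` is concave along
segments. -/
theorem concaveOn_qaMean_segment (hI : I.OrdConnected)
    (hg : ∀ x ∈ I, HasDerivWithinAt g (G x) I x)
    (hG : ∀ x ∈ I, HasDerivWithinAt G (-G x / U x) I x) (hGpos : ∀ x ∈ I, 0 < G x)
    (hUpos : ∀ x ∈ I, 0 < U x) (hU : ConcaveOn ℝ I U) {n : ℕ} (hn : 1 ≤ n) {x y : Fin n → ℝ}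
    (hx : x ∈ cube I n) (hy : y ∈ cube I n) :
    ConcaveOn ℝ (Icc (0 : ℝ) 1) fun t => qaMean I g ⟨n, fun i => x i + t * (y i - x i)⟩ := by
  have hgc : ContinuousOn g I := fun x hx => (hg x hx).continuousWithinAt
  have hm := strictMonoOn_of_hasDerivWithinAt_pos hI hg hGpos
  have hn' : 0 < (n : ℝ) := by positivity
  have hz : ∀ t ∈ Icc (0 : ℝ) 1, ∀ i, x i + t * (y i - x i) ∈ I := by
    intro t ht i
    have := hI.convex (hx i) (hy i) (sub_nonneg.2 ht.2) ht.1 (by ring)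
    simp only [smul_eq_mul] at this
    convert this using 1
    ring
  have htup : ∀ t ∈ Icc (0 : ℝ) 1, (⟨n, fun i => x i + t * (y i - x i)⟩ : Tuple) ∈ tuples I :=
    fun t ht => ⟨hn, hz t ht⟩
  have hzd : ∀ i t, HasDerivWithinAt (fun t => x i + t * (y i - x i)) (y i - x i) (Icc 0 1) t := by
    intro i t
    simpa using (((hasDerivAt_id t).mul_const (y i - x i)).const_add (x i)).hasDerivWithinAt
  have hSd : ∀ t ∈ Icc (0 : ℝ) 1,
      HasDerivWithinAt (fun t => (∑ i, g (x i + t * (y i - x i))) / (n : ℝ))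
        ((∑ i, G (x i + t * (y i - x i)) * (y i - x i)) / (n : ℝ)) (Icc 0 1) t := by
    intro t ht
    refine HasDerivWithinAt.div_const (HasDerivWithinAt.fun_sum fun i _ => ?_) _
    exact (hg _ (hz t ht i)).comp t (hzd i t) fun s hs => hz s hs i
  have hSd2 : ∀ t ∈ Icc (0 : ℝ) 1,
      HasDerivWithinAt (fun t => (∑ i, G (x i + t * (y i - x i)) * (y i - x i)) / (n : ℝ))
        ((∑ i, -G (x i + t * (y i - x i)) / U (x i + t * (y i - x i)) * (y i - x i) * (y i - x i))
          / (n : ℝ)) (Icc 0 1) t := by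
    intro t ht
    refine HasDerivWithinAt.div_const (HasDerivWithinAt.fun_sum fun i _ => ?_) _
    exact ((hG _ (hz t ht i)).comp t (hzd i t) fun s hs => hz s hs i).mul_const _
  set S : ℝ → ℝ := fun t => (∑ i, g (x i + t * (y i - x i))) / (n : ℝ) with hS
  set S' : ℝ → ℝ := fun t => (∑ i, G (x i + t * (y i - x i)) * (y i - x i)) / (n : ℝ) with hS'
  set S'' : ℝ → ℝ := fun t => (∑ i, -G (x i + t * (y i - x i)) / U (x i + t * (y i - x i)) *
    (y i - x i) * (y i - x i)) / (n : ℝ) with hS''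
  set m : ℝ → ℝ := fun t => qaMean I g ⟨n, fun i => x i + t * (y i - x i)⟩ with hmdef
  have hmI : ∀ t ∈ Icc (0 : ℝ) 1, m t ∈ I := fun t ht => qaMean_mem hI hgc (htup t ht)
  have hgm : ∀ t ∈ Icc (0 : ℝ) 1, g (m t) = S t := fun t ht => apply_qaMean hI hgc (htup t ht)
  have hmc : ContinuousOn m (Icc 0 1) :=
    (continuousOn_invFunOn hI hgc hm).comp (fun t ht => (hSd t ht).continuousWithinAt)
      fun t ht => avg_mem_image hI hgc (htup t ht)
  have hnhds : ∀ t ∈ interior (Icc (0 : ℝ) 1), Icc (0 : ℝ) 1 ∈ 𝓝 t :=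
    fun t ht => mem_interior_iff_mem_nhds.1 ht
  have hmd : ∀ t ∈ interior (Icc (0 : ℝ) 1), HasDerivAt m (S' t / G (m t)) t := by
    intro t ht
    have htI := interior_subset ht
    refine hasDerivAt_of_comp_eq (hmc.continuousAt (hnhds t ht)) ?_ ?_ (hg _ (hmI t htI))
      (hGpos _ (hmI t htI)).ne' ((hSd t htI).hasDerivAt (hnhds t ht))
    · filter_upwards [hnhds t ht] with s hs using hmI s hs
    · filter_upwards [hnhds t ht] with s hs using hgm s hs
  have hGm : ∀ t ∈ interior (Icc (0 : ℝ) 1),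
      HasDerivAt (fun s => G (m s)) (-G (m t) / U (m t) * (S' t / G (m t))) t := by
    intro t ht
    have htI := interior_subset ht
    have := (hG _ (hmI t htI)).comp t (hmd t ht).hasDerivWithinAt hmI
    exact this.hasDerivAt (hnhds t ht)
  refine concaveOn_of_hasDerivWithinAt2_nonpos (convex_Icc 0 1) hmc
    (fun t ht => (hmd t ht).hasDerivWithinAt)
    (f'' := fun t => (S'' t * G (m t) - S' t * (-G (m t) / U (m t) * (S' t / G (m t)))) /
      G (m t) ^ 2)
    (fun t ht => ((((hSd2 t (interior_subset ht)).hasDerivAt (hnhds t ht)).div (hGm t ht)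
      (hGpos _ (hmI t (interior_subset ht))).ne')).hasDerivWithinAt) fun t ht => ?_
  have htI := interior_subset ht
  have p1 := hGpos _ (hmI t htI)
  have p2 := hUpos _ (hmI t htI)
  refine div_nonpos_of_nonpos_of_nonneg ?_ (sq_nonneg _)
  -- The numerator of `m''` is nonpositive iff `S'² ≤ -S'' * G(m) * U(m)`. Cauchy–Schwarz, splitting
  -- `G` as the product of the square roots of `G / U` and `G * U`, gives the bound with the average
  -- of `G * U`; that average is at most the value at the mean by `avg_weight_le`.
  have cs : (∑ i, G (x i + t * (y i - x i)) * (y i - x i)) ^ 2 ≤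
      (∑ i, G (x i + t * (y i - x i)) / U (x i + t * (y i - x i)) * (y i - x i) * (y i - x i)) *
      ∑ i, G (x i + t * (y i - x i)) * U (x i + t * (y i - x i)) := by
    refine Finset.sum_sq_le_sum_mul_sum_of_sq_le_mul _ (fun i _ => ?_) (fun i _ => ?_)
      fun i _ => le_of_eq ?_
    · have := hGpos _ (hz t htI i)
      have := hUpos _ (hz t htI i)
      rw [mul_assoc]
      exact mul_nonneg (by positivity) (mul_self_nonneg _)
    · have := hGpos _ (hz t htI i)
      have := hUpos _ (hz t htI i)
      positivity
    · have := hUpos _ (hz t htI i)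
      field_simp
  have hw := avg_weight_le hI hg hG hGpos hUpos hU (htup t htI)
  change _ ≤ G (m t) * U (m t) at hw
  set A := ∑ i, G (x i + t * (y i - x i)) / U (x i + t * (y i - x i)) * (y i - x i) * (y i - x i)
    with hA
  set B := ∑ i, G (x i + t * (y i - x i)) * U (x i + t * (y i - x i)) with hB
  have hA0 : 0 ≤ A := Finset.sum_nonneg fun i _ => by
    have := hGpos _ (hz t htI i)
    have := hUpos _ (hz t htI i)
    rw [mul_assoc]
    exact mul_nonneg (by positivity) (mul_self_nonneg _)
  have hSA : S'' t = -(A / n) := by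
    simp only [hS'', hA, neg_div, neg_mul, Finset.sum_neg_distrib]
  have hkey : S' t ^ 2 ≤ A / n * (G (m t) * U (m t)) := by
    calc S' t ^ 2 = (∑ i, G (x i + t * (y i - x i)) * (y i - x i)) ^ 2 / (n : ℝ) ^ 2 := by
          simp only [hS', div_pow]
      _ ≤ A * B / (n : ℝ) ^ 2 := div_le_div_of_nonneg_right cs (sq_nonneg _)
      _ = A / n * (B / n) := by field_simp
      _ ≤ _ := mul_le_mul_of_nonneg_left hw (div_nonneg hA0 hn'.le)
  rw [hSA]
  have e : -(A / n) * G (m t) - S' t * (-G (m t) / U (m t) * (S' t / G (m t))) =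
      (S' t ^ 2 - A / n * (G (m t) * U (m t))) / U (m t) := by field_simp; ring
  rw [e]
  exact div_nonpos_of_nonpos_of_nonneg (by linarith) p2.le

/-- If `-g' / g''` is concave and positive, then the mean generated by `g` is Jensen concave. -/
theorem isJensenConcaveMean_of_concaveOn (hI : I.OrdConnected)
    (hg : ∀ x ∈ I, HasDerivWithinAt g (G x) I x)
    (hG : ∀ x ∈ I, HasDerivWithinAt G (-G x / U x) I x) (hGpos : ∀ x ∈ I, 0 < G x)
    (hUpos : ∀ x ∈ I, 0 < U x) (hU : ConcaveOn ℝ I U) : IsJensenConcaveMean I (qaMean I g) := by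
  intro n hn x hx y hy
  have := (concaveOn_qaMean_segment hI hg hG hGpos hUpos hU hn hx hy).2
    (left_mem_Icc.2 zero_le_one) (right_mem_Icc.2 zero_le_one)
    (by norm_num : (0 : ℝ) ≤ 2⁻¹) (by norm_num : (0 : ℝ) ≤ 2⁻¹) (by norm_num)
  simp only [smul_eq_mul, mul_zero, mul_one, zero_add, zero_mul, add_zero, one_mul] at this
  have e1 : (fun i => x i + 2⁻¹ * (y i - x i)) = (2⁻¹ : ℝ) • (x + y) := by
    ext i
    simp only [Pi.smul_apply, Pi.add_apply, smul_eq_mul]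
    ring
  have e2 : (fun i => x i + (y i - x i)) = y := by
    ext i
    ring
  rw [e1, e2] at this
  change _ ≤ qaMean I g ⟨n, (2⁻¹ : ℝ) • (x + y)⟩
  change 2⁻¹ * qaMean I g ⟨n, x⟩ + _ ≤ _ at this
  change (qaMean I g ⟨n, x⟩ + qaMean I g ⟨n, y⟩) / 2 ≤ _
  linarith

end Sufficiency

/-! ### One-sided derivatives and continuity of monotone derivatives -/

section OneSided

theorem derivWithin_neg_le_of_concaveOn {s : Set ℝ} {f : ℝ → ℝ} (hf : ConcaveOn ℝ s f) {x r l : ℝ}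
    (hx : x ∈ interior s) (hr : HasDerivWithinAt f r (Ioi x) x)
    (hl : HasDerivWithinAt f l (Iio x) x) : r ≤ l := by
  have h := hf.neg.leftDeriv_le_rightDeriv_of_mem_interior hx
  rw [hr.neg.derivWithin (uniqueDiffWithinAt_Ioi x),
    hl.neg.derivWithin (uniqueDiffWithinAt_Iio x)] at h
  linarith

theorem leftDeriv_le_rightDeriv_of_convexOn {s : Set ℝ} {f : ℝ → ℝ} (hf : ConvexOn ℝ s f)
    {x r l : ℝ} (hx : x ∈ interior s) (hr : HasDerivWithinAt f r (Ioi x) x)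
    (hl : HasDerivWithinAt f l (Iio x) x) : l ≤ r := by
  have h := hf.leftDeriv_le_rightDeriv_of_mem_interior hx
  rwa [hr.derivWithin (uniqueDiffWithinAt_Ioi x), hl.derivWithin (uniqueDiffWithinAt_Iio x)] at h

theorem hasDerivAt_of_left_right {f : ℝ → ℝ} {x d : ℝ} (hr : HasDerivWithinAt f d (Ioi x) x)
    (hl : HasDerivWithinAt f d (Iio x) x) : HasDerivAt f d x := by
  have := hl.Iic_of_Iio.union hr.Ici_of_Ioi
  rwa [Iic_union_Ici, hasDerivWithinAt_univ] at this

/-- One-sided version of `hasDerivAt_of_comp_eq`. -/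
theorem hasDerivWithinAt_of_comp_eq {h m G : ℝ → ℝ} {s T : Set ℝ} {t h' G' : ℝ} (hts : t ∈ s)
    (hm : Tendsto m (𝓝[s] t) (𝓝[T] (m t))) (hcomp : ∀ᶠ r in 𝓝[s] t, h (m r) = G r)
    (hh : HasDerivWithinAt h h' T (m t)) (h0 : h' ≠ 0) (hG : HasDerivWithinAt G G' s t) :
    HasDerivWithinAt m (G' / h') s t := by
  have := HasFDerivWithinAt.of_comp_of_leftInverse (g := m) (f := h) (h := G) (s := s) (t := T)
    (a := t) (f'symm := ContinuousLinearMap.toSpanSingleton ℝ (h'⁻¹))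
    hm hh.hasFDerivWithinAt hG.hasFDerivWithinAt hcomp (fun x => by simp [h0]) hts
  have := this.hasDerivWithinAt
  simpa [div_eq_mul_inv] using this

/-- A monotone derivative is continuous. -/
theorem continuousOn_of_hasDerivAt_of_monotoneOn {K : Set ℝ} (hK : K.OrdConnected)
    (hKo : IsOpen K) {φ φ' : ℝ → ℝ} (hφ : ∀ x ∈ K, HasDerivAt φ (φ' x) x)
    (hm : MonotoneOn φ' K) : ContinuousOn φ' K := by
  -- Adding `x` makes the derivative strictly increasing, so each value is interior to the image,
  -- which is an interval by Darboux's theorem. A monotone function with such an image is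
  -- continuous.
  have hs : StrictMonoOn (fun x => φ' x + x) K := fun x hx y hy hxy =>
    add_lt_add_of_le_of_lt (hm hx hy hxy.le) hxy
  have himg : ((fun x => φ' x + x) '' K).OrdConnected := by
    refine hK.image_hasDerivWithinAt (f := fun x => φ x + x ^ 2 / 2) fun x hx => ?_
    have h2 : HasDerivAt (fun x : ℝ => x ^ 2 / 2) x x := by
      have := (hasDerivAt_pow 2 x).div_const 2
      simpa using this
    exact ((hφ x hx).add h2).hasDerivWithinAt
  intro x hx
  have hc : ContinuousAt (fun x => φ' x + x) x := by
    refine continuousAt_of_monotoneOn_of_image_mem_nhds hs.monotoneOn (hKo.mem_nhds hx) ?_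
    obtain ⟨a, b, hab, hsub⟩ := mem_nhds_iff_exists_Ioo_subset.1 (hKo.mem_nhds hx)
    obtain ⟨c, hac, hcx⟩ := exists_between hab.1
    obtain ⟨d, hxd, hdb⟩ := exists_between hab.2
    have hcK : c ∈ K := hsub ⟨hac, hcx.trans hab.2⟩
    have hdK : d ∈ K := hsub ⟨hab.1.trans hxd, hdb⟩
    exact mem_interior_iff_mem_nhds.1 (mem_interior_of_lt_lt himg
      (mem_image_of_mem _ hcK) (mem_image_of_mem _ hdK) (hs hcK hx hcx) (hs hx hdK hxd))
  have := hc.sub (continuousAt_id (x := x))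
  exact ContinuousAt.continuousWithinAt (by simpa [Pi.sub_def] using this)

theorem exists_lt_mem_of_isOpen {K : Set ℝ} (hK : IsOpen K) {x : ℝ} (hx : x ∈ K) :
    ∃ y ∈ K, y < x := by
  obtain ⟨a, b, hab, hsub⟩ := mem_nhds_iff_exists_Ioo_subset.1 (hK.mem_nhds hx)
  obtain ⟨c, hac, hcx⟩ := exists_between hab.1
  exact ⟨c, hsub ⟨hac, hcx.trans hab.2⟩, hcx⟩

theorem exists_gt_mem_of_isOpen {K : Set ℝ} (hK : IsOpen K) {x : ℝ} (hx : x ∈ K) :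
    ∃ y ∈ K, x < y := by
  obtain ⟨a, b, hab, hsub⟩ := mem_nhds_iff_exists_Ioo_subset.1 (hK.mem_nhds hx)
  obtain ⟨d, hxd, hdb⟩ := exists_between hab.2
  exact ⟨d, hsub ⟨hab.1.trans hxd, hdb⟩, hxd⟩

end OneSided

/-! ### First-order consequences of concavity of the two-variable mean -/

section Mean2

variable {I : Set ℝ} {h : ℝ → ℝ}

/-- Jensen concavity of the two-variable mean generated by `h`. -/
def Mean2JensenConcave (I : Set ℝ) (h : ℝ → ℝ) : Prop :=
  ∀ x ∈ I, ∀ y ∈ I, ∀ x' ∈ I, ∀ y' ∈ I,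
    (mean2 I h x y + mean2 I h x' y') / 2 ≤ mean2 I h ((x + x') / 2) ((y + y') / 2)

theorem mean2_eq_invFunOn (x y : ℝ) :
    mean2 I h x y = Function.invFunOn h I ((h x + h y) / 2) := by
  simp [mean2, qaMean]

theorem avg2_mem {s : Set ℝ} (hs : s.OrdConnected) {x y : ℝ} (hx : x ∈ s) (hy : y ∈ s) :
    (x + y) / 2 ∈ s := by
  have := hs.convex hx hy (by norm_num : (0 : ℝ) ≤ 2⁻¹) (by norm_num : (0 : ℝ) ≤ 2⁻¹) (by norm_num)
  convert this using 1
  simp only [smul_eq_mul]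
  ring

theorem mean2_eq (hm : StrictMonoOn h I) {x y z : ℝ} (hz : z ∈ I)
    (hz' : h z = (h x + h y) / 2) : mean2 I h x y = z := by
  rw [mean2_eq_invFunOn, ← hz', invFunOn_apply hm.injOn hz]

theorem concaveOn_mean2_line (hI : I.OrdConnected) (hc : ContinuousOn h I)
    (hm : StrictMonoOn h I) (hJ : Mean2JensenConcave I h) {T : Set ℝ} (hT : Convex ℝ T)
    {x y u v : ℝ} (hx : ∀ t ∈ T, x + t * u ∈ I) (hy : ∀ t ∈ T, y + t * v ∈ I) :
    ConcaveOn ℝ T (fun t => mean2 I h (x + t * u) (y + t * v)) := by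
  refine concaveOn_of_midpoint hT ?_ fun s hs t ht => ?_
  · simp only [mean2_eq_invFunOn]
    refine (continuousOn_invFunOn hI hc hm).comp ?_ fun t ht =>
      avg2_mem (ordConnected_image hI hc) (mem_image_of_mem h (hx t ht))
        (mem_image_of_mem h (hy t ht))
    exact ((hc.comp (by fun_prop) hx).add (hc.comp (by fun_prop) hy)).div_const 2
  · have := hJ _ (hx s hs) _ (hy s hs) _ (hx t ht) _ (hy t ht)
    convert this using 2 <;> ring

/-- Concavity applied to `(x, y)` and its swap `(y, x)` puts the symmetric mean below the arithmetic
mean. -/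
theorem concaveOn_of_mean2 (hI : I.OrdConnected) (hc : ContinuousOn h I)
    (hm : StrictMonoOn h I) (hJ : Mean2JensenConcave I h) : ConcaveOn ℝ I h := by
  refine concaveOn_of_midpoint hI.convex hc fun x hx y hy => ?_
  have h1 := hJ x hx y hy y hy x hx
  have hmid := avg2_mem hI hx hy
  have e1 : mean2 I h y x = mean2 I h x y := by
    rw [mean2_eq_invFunOn, mean2_eq_invFunOn, add_comm]
  rw [e1, add_comm y x, mean2_eq hm (x := (x + y) / 2) (y := (x + y) / 2) hmid (by ring)] at h1
  rw [← apply_mean2 hI hc hx hy]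
  exact hm.monotoneOn (mean2_mem hI hc hx hy) hmid (by linarith)

theorem exists_left_right_deriv (ho : IsOpen I) (hm : StrictMonoOn h I)
    (hconc : ConcaveOn ℝ I h) {c : ℝ} (hcI : c ∈ I) :
    ∃ r l, HasDerivWithinAt h r (Ioi c) c ∧ HasDerivWithinAt h l (Iio c) c ∧ 0 < r ∧ r ≤ l := by
  have hint : c ∈ interior I := by rwa [ho.interior_eq]
  have h1 := (hconc.neg.differentiableWithinAt_Ioi_of_mem_interior hint).neg
  have h2 := (hconc.neg.differentiableWithinAt_Iio_of_mem_interior hint).neg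
  rw [neg_neg] at h1 h2
  have hle := derivWithin_neg_le_of_concaveOn hconc hint h1.hasDerivWithinAt h2.hasDerivWithinAt
  refine ⟨_, _, h1.hasDerivWithinAt, h2.hasDerivWithinAt, ?_, hle⟩
  obtain ⟨z, hz, hcz⟩ := exists_gt_mem_of_isOpen ho hcI
  have := hconc.slope_le_of_hasDerivWithinAt_Ioi hcI hz hcz h1.hasDerivWithinAt
  refine lt_of_lt_of_le ?_ this
  rw [slope_def_field]
  exact div_pos (sub_pos.2 (hm hcI hz hcz)) (sub_pos.2 hcz)

theorem isOpen_image (hI : I.OrdConnected) (ho : IsOpen I) (hc : ContinuousOn h I)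
    (hm : StrictMonoOn h I) : IsOpen (h '' I) := by
  rw [← subset_interior_iff_isOpen]
  rintro _ ⟨x, hx, rfl⟩
  exact mem_interior_image hI hc hm (by rwa [ho.interior_eq])

/-- Concavity of `h` gives one-sided derivatives `r ≤ l` at `c`. Take a point `x` of
differentiability and `y` with mean of `x` and `y` equal to `c`. The concave function `t ↦ mean2 I h
t y` has right and left derivatives `h' x / (2 r)` and `h' x / (2 l)` at `x`, whence `l ≤ r`. -/
theorem exists_hasDerivAt_of_mean2 (hI : I.OrdConnected) (ho : IsOpen I) (hc : ContinuousOn h I)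
    (hm : StrictMonoOn h I) (hJ : Mean2JensenConcave I h) {c : ℝ} (hcI : c ∈ I) :
    ∃ d, 0 < d ∧ HasDerivAt h d c := by
  have hconc := concaveOn_of_mean2 hI hc hm hJ
  obtain ⟨r, l, hr, hl, hr0, hrl⟩ := exists_left_right_deriv ho hm hconc hcI
  have hKo := isOpen_image hI ho hc hm
  have hae := MonotoneOn.ae_differentiableWithinAt_of_mem hm.monotoneOn
  have hdense := MeasureTheory.Measure.dense_of_ae hae
  -- Every `x` near `c` has a partner `y` in `I` with `h x + h y = 2 * h c`; monotone functions are
  -- differentiable almost everywhere, so `x` can be chosen as such a point.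
  have hpre : I ∩ h ⁻¹' {z | 2 * h c - z ∈ h '' I} ∈ 𝓝 c := by
    refine inter_mem (ho.mem_nhds hcI) ((hc.continuousAt (ho.mem_nhds hcI)).preimage_mem_nhds ?_)
    refine (hKo.preimage (by fun_prop : Continuous fun z => 2 * h c - z)).mem_nhds ?_
    change 2 * h c - h c ∈ h '' I
    rw [show 2 * h c - h c = h c by ring]
    exact mem_image_of_mem h hcI
  obtain ⟨V, hVsub, hVo, hcV⟩ := mem_nhds_iff.1 hpre
  obtain ⟨x, hxV, hxd⟩ := hdense.inter_open_nonempty V hVo ⟨c, hcV⟩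
  obtain ⟨hxI, y, hyI, hy⟩ := hVsub hxV
  have hxD : DifferentiableAt ℝ h x := (hxd hxI).differentiableAt (ho.mem_nhds hxI)
  obtain ⟨r', l', hr', hl', hr0', -⟩ := exists_left_right_deriv ho hm hconc hxI
  have hD : 0 < deriv h x := by
    have := (uniqueDiffWithinAt_Ioi x).eq_deriv _ hr' hxD.hasDerivAt.hasDerivWithinAt
    rwa [← this]
  have hmc : mean2 I h x y = c := mean2_eq hm hcI (by rw [hy]; ring)
  have hconc2 : ConcaveOn ℝ I (fun t => mean2 I h t y) := by
    have := concaveOn_mean2_line hI hc hm hJ hI.convex (x := 0) (y := y) (u := 1) (v := 0)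
      (fun t ht => by simpa using ht) (fun t ht => by simpa using hyI)
    simpa using this
  have hcont : ContinuousAt (fun t => mean2 I h t y) x :=
    (neg_neg (fun t => mean2 I h t y) ▸ (hconc2.neg.continuousOn ho).neg).continuousAt
      (ho.mem_nhds hxI)
  have hmonom : MonotoneOn (fun t => mean2 I h t y) I := fun s hs t ht hst => by
    rw [← hm.le_iff_le (mean2_mem hI hc hs hyI) (mean2_mem hI hc ht hyI),
      apply_mean2 hI hc hs hyI, apply_mean2 hI hc ht hyI]
    have := hm.monotoneOn hs ht hst
    linarith
  have hG : HasDerivAt (fun t => (h t + h y) / 2) (deriv h x / 2) x :=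
    (hxD.hasDerivAt.add_const _).div_const 2
  have happ : ∀ᶠ t in 𝓝 x, h (mean2 I h t y) = (h t + h y) / 2 := by
    filter_upwards [ho.mem_nhds hxI] with t ht using apply_mean2 hI hc ht hyI
  -- As `t` moves right from `x` the mean moves right from `c`, so only the right derivative of `h`
  -- at `c` enters.
  have hR : HasDerivWithinAt (fun t => mean2 I h t y) (deriv h x / 2 / r) (Ici x) x := by
    refine hasDerivWithinAt_of_comp_eq (h := h) (T := Ici c) self_mem_Ici ?_
      (happ.filter_mono nhdsWithin_le_nhds) ?_ hr0.ne' hG.hasDerivWithinAt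
    · rw [hmc]
      refine tendsto_nhdsWithin_iff.2 ⟨?_, ?_⟩
      · have := hcont.tendsto.mono_left (nhdsWithin_le_nhds (s := Ici x))
        rwa [hmc] at this
      · filter_upwards [self_mem_nhdsWithin, nhdsWithin_le_nhds (ho.mem_nhds hxI)] with t ht ht'
        have := hmonom hxI ht' ht
        simp only [hmc] at this
        exact this
    · rw [hmc]
      exact hr.Ici_of_Ioi
  have hL : HasDerivWithinAt (fun t => mean2 I h t y) (deriv h x / 2 / l) (Iic x) x := by
    refine hasDerivWithinAt_of_comp_eq (h := h) (T := Iic c) self_mem_Iic ?_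
      (happ.filter_mono nhdsWithin_le_nhds) ?_ (hr0.trans_le hrl).ne' hG.hasDerivWithinAt
    · rw [hmc]
      refine tendsto_nhdsWithin_iff.2 ⟨?_, ?_⟩
      · have := hcont.tendsto.mono_left (nhdsWithin_le_nhds (s := Iic x))
        rwa [hmc] at this
      · filter_upwards [self_mem_nhdsWithin, nhdsWithin_le_nhds (ho.mem_nhds hxI)] with t ht ht'
        have := hmonom ht' hxI ht
        simp only [hmc] at this
        exact this
    · rw [hmc]
      exact hl.Iic_of_Iio
  have hle := derivWithin_neg_le_of_concaveOn hconc2 (by rwa [ho.interior_eq])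
    (hR.mono Ioi_subset_Ici_self) (hL.mono Iio_subset_Iic_self)
  have hlr : l ≤ r := (div_le_div_iff_of_pos_left (by positivity) hr0 (hr0.trans_le hrl)).1 hle
  have heq : r = l := le_antisymm hrl hlr
  exact ⟨r, hr0, hasDerivAt_of_left_right hr (heq ▸ hl)⟩

/-- A concave function lies below its tangents, and the partial derivatives of the mean at `(x, y)`
are `d x` and `d y` divided by `2 * d (mean2 I h x y)`. -/
theorem tangent_le_of_mean2 (hI : I.OrdConnected) (ho : IsOpen I) (hc : ContinuousOn h I)
    (hm : StrictMonoOn h I) (hJ : Mean2JensenConcave I h) {d : ℝ → ℝ}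
    (hd : ∀ x ∈ I, HasDerivAt h (d x) x) (hpos : ∀ x ∈ I, 0 < d x) {x y u v : ℝ} (hx : x ∈ I)
    (hy : y ∈ I) (hu : u ∈ I) (hv : v ∈ I) :
    d (mean2 I h x y) * (mean2 I h u v - mean2 I h x y) ≤
      (d x * (u - x) + d y * (v - y)) / 2 := by
  have hline : ∀ x ∈ I, ∀ u ∈ I, ∀ t ∈ Icc (0 : ℝ) 1, x + t * (u - x) ∈ I := by
    intro x hx u hu t ht
    have := hI.convex hx hu (sub_nonneg.2 ht.2) ht.1 (by ring)
    simp only [smul_eq_mul] at this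
    convert this using 1
    ring
  have hconc := concaveOn_mean2_line hI hc hm hJ (convex_Icc 0 1) (hline x hx u hu)
    (hline y hy v hv)
  have e0 : mean2 I h (x + 0 * (u - x)) (y + 0 * (v - y)) = mean2 I h x y := by simp
  have e1 : mean2 I h (x + 1 * (u - x)) (y + 1 * (v - y)) = mean2 I h u v := by simp
  have hM := mean2_mem hI hc hx hy
  have hlc : ∀ x u : ℝ, HasDerivAt (fun t => x + t * (u - x)) (u - x) 0 := fun x u => by
    simpa using ((hasDerivAt_id (0 : ℝ)).mul_const (u - x)).const_add x
  have hev : ∀ x ∈ I, ∀ u : ℝ, ∀ᶠ t in 𝓝 (0 : ℝ), x + t * (u - x) ∈ I := fun x hx u =>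
    (hlc x u).continuousAt.eventually_mem (ho.mem_nhds (by simpa using hx))
  have hS : ∀ x ∈ I, ∀ u : ℝ, HasDerivAt (fun t => h (x + t * (u - x))) (d x * (u - x)) 0 :=
    fun x hx u => by
      have h1 := hd x hx
      have e : x = x + 0 * (u - x) := by ring
      rw [e] at h1
      have := h1.comp 0 (hlc x u)
      rwa [← e] at this
  have hG := ((hS x hx u).add (hS y hy v)).div_const 2
  have hcont : ContinuousAt (fun t => mean2 I h (x + t * (u - x)) (y + t * (v - y))) 0 := by
    simp only [mean2_eq_invFunOn]
    refine ContinuousAt.comp (g := Function.invFunOn h I) ?_ hG.continuousAt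
    simp only [zero_mul, add_zero]
    exact (continuousOn_invFunOn hI hc hm).continuousAt ((isOpen_image hI ho hc hm).mem_nhds
      (avg2_mem (ordConnected_image hI hc) (mem_image_of_mem h hx) (mem_image_of_mem h hy)))
  have hder := hasDerivAt_of_comp_eq (I := I) (h := h) (h' := d (mean2 I h x y)) hcont
    (by filter_upwards [hev x hx u, hev y hy v] with t h1 h2 using mean2_mem hI hc h1 h2)
    (by filter_upwards [hev x hx u, hev y hy v] with t h1 h2 using apply_mean2 hI hc h1 h2)
    (by rw [e0]; exact (hd _ hM).hasDerivWithinAt) (hpos _ hM).ne' hG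
  have := hconc.slope_le_of_hasDerivAt (left_mem_Icc.2 zero_le_one) (right_mem_Icc.2 zero_le_one)
    zero_lt_one hder
  rw [slope_def_field, e0, e1, sub_zero, div_one] at this
  have := (le_div_iff₀ (hpos _ hM)).1 this
  linarith

end Mean2

/-! ### Jointly convex kernels `q a * (k b - k a)` with `k' = 1 / q` -/

section Kernel

/-- Joint midpoint convexity of `(a, b) ↦ q a * (k b - k a)`. -/
def KernelJensenConvex (K : Set ℝ) (k q : ℝ → ℝ) : Prop :=
  ∀ a ∈ K, ∀ b ∈ K, ∀ a' ∈ K, ∀ b' ∈ K,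
    q ((a + a') / 2) * (k ((b + b') / 2) - k ((a + a') / 2)) ≤
      (q a * (k b - k a) + q a' * (k b' - k a')) / 2

variable {K : Set ℝ} {k q : ℝ → ℝ}

theorem convexOn_kernel (hK : K.OrdConnected) (hk : ContinuousOn k K) (hq : ContinuousOn q K)
    (hJ : KernelJensenConvex K k q) {b : ℝ} (hb : b ∈ K) :
    ConvexOn ℝ K (fun a => q a * (k b - k a)) := by
  refine convexOn_of_midpoint hK.convex (hq.mul (continuousOn_const.sub hk)) fun a ha a' ha' => ?_
  have := hJ a ha b hb a' ha' b hb
  rwa [show (b + b) / 2 = b by ring] at this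

theorem convexOn_kernel_line (hk : ContinuousOn k K) (hq : ContinuousOn q K)
    (hJ : KernelJensenConvex K k q) {T : Set ℝ} (hT : Convex ℝ T) {a b β : ℝ}
    (ha : ∀ t ∈ T, a + t ∈ K) (hb : ∀ t ∈ T, b + β * t ∈ K) :
    ConvexOn ℝ T (fun t => q (a + t) * (k (b + β * t) - k (a + t))) := by
  refine convexOn_of_midpoint hT ?_ fun s hs t ht => ?_
  · exact (hq.comp (by fun_prop) ha).mul
      ((hk.comp (by fun_prop) hb).sub (hk.comp (by fun_prop) ha))
  · have := hJ _ (ha s hs) _ (hb s hs) _ (ha t ht) _ (hb t ht)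
    convert this using 2 <;> ring_nf

/-- Two kernels with fixed second arguments `b < a < c` recover `q` as a multiple of a difference of
convex functions, so `q` has one-sided derivatives. The factors `k c - k a` and `k b - k a` have
opposite signs, so convexity of the two kernels orders these derivatives both ways. -/
theorem exists_hasDerivAt_kernel (hK : K.OrdConnected) (ho : IsOpen K) (hkm : StrictMonoOn k K)
    (hk : ∀ a ∈ K, HasDerivAt k (1 / q a) a) (hq : ContinuousOn q K)
    (hJ : KernelJensenConvex K k q) {a : ℝ} (ha : a ∈ K) : ∃ q', HasDerivAt q q' a := by
  have hkc : ContinuousOn k K := fun x hx => (hk x hx).continuousAt.continuousWithinAt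
  obtain ⟨b, hb, hba⟩ := exists_lt_mem_of_isOpen ho ha
  obtain ⟨c, hc, hac⟩ := exists_gt_mem_of_isOpen ho ha
  have hint : a ∈ interior K := by rwa [ho.interior_eq]
  have hkb := hkm hb ha hba
  have hkc' := hkm ha hc hac
  have cb := convexOn_kernel hK hkc hq hJ hb
  have cc := convexOn_kernel hK hkc hq hJ hc
  have hqe : q = fun t => (q t * (k c - k t) - q t * (k b - k t)) / (k c - k b) := by
    ext t
    have : k c - k b ≠ 0 := by linarith
    field_simp
    ring
  have one : ∀ S : Set ℝ, DifferentiableWithinAt ℝ (fun t => q t * (k c - k t)) S a →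
      DifferentiableWithinAt ℝ (fun t => q t * (k b - k t)) S a →
      ∃ r, HasDerivWithinAt q r S a := by
    intro S h1 h2
    rw [hqe]
    exact ⟨_, ((h1.hasDerivWithinAt.sub h2.hasDerivWithinAt).div_const _)⟩
  obtain ⟨r, hr⟩ := one _ (cc.differentiableWithinAt_Ioi_of_mem_interior hint)
    (cb.differentiableWithinAt_Ioi_of_mem_interior hint)
  obtain ⟨l, hl⟩ := one _ (cc.differentiableWithinAt_Iio_of_mem_interior hint)
    (cb.differentiableWithinAt_Iio_of_mem_interior hint)
  have two : ∀ (z : ℝ) (S : Set ℝ) (s : ℝ), HasDerivWithinAt q s S a →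
      HasDerivWithinAt (fun t => q t * (k z - k t)) (s * (k z - k a) + q a * (-(1 / q a))) S a :=
    fun z S s hs => hs.mul ((hk a ha).hasDerivWithinAt.const_sub (k z))
  have l1 := leftDeriv_le_rightDeriv_of_convexOn cc hint (two c _ r hr) (two c _ l hl)
  have l2 := leftDeriv_le_rightDeriv_of_convexOn cb hint (two b _ r hr) (two b _ l hl)
  have hlr : l ≤ r := le_of_mul_le_mul_right (by linarith) (sub_pos.2 hkc')
  have hrl : r ≤ l := by nlinarith
  exact ⟨r, hasDerivAt_of_left_right hr (le_antisymm hlr hrl ▸ hl)⟩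

/-- Derivatives of differentiable convex functions are continuous; subtracting those for two second
arguments isolates `q'`. -/
theorem continuousOn_deriv_kernel (hK : K.OrdConnected) (ho : IsOpen K) (hkm : StrictMonoOn k K)
    (hk : ∀ a ∈ K, HasDerivAt k (1 / q a) a) (hJ : KernelJensenConvex K k q) {q' : ℝ → ℝ}
    (hq' : ∀ a ∈ K, HasDerivAt q (q' a) a) : ContinuousOn q' K := by
  intro a ha
  have hkc : ContinuousOn k K := fun x hx => (hk x hx).continuousAt.continuousWithinAt
  have hqc : ContinuousOn q K := fun x hx => (hq' x hx).continuousAt.continuousWithinAt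
  obtain ⟨b, hb, hba⟩ := exists_lt_mem_of_isOpen ho ha
  have hkb := hkm hb ha hba
  have hder : ∀ c ∈ K, ∀ x ∈ K, HasDerivAt (fun t => q t * (k c - k t))
      (q' x * (k c - k x) + q x * (-(1 / q x))) x :=
    fun c _ x hx => (hq' x hx).mul ((hk x hx).const_sub (k c))
  have hcont : ∀ c ∈ K,
      ContinuousOn (fun x => q' x * (k c - k x) + q x * (-(1 / q x))) K := by
    intro c hc
    refine continuousOn_of_hasDerivAt_of_monotoneOn hK ho (hder c hc) fun x hx y hy hxy => ?_
    have := (convexOn_kernel hK hkc hqc hJ hc).monotoneOn_deriv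
      (fun x hx => (hder c hc x hx).differentiableAt) hx hy hxy
    rwa [(hder c hc x hx).deriv, (hder c hc y hy).deriv] at this
  have := ((hcont a ha).sub (hcont b hb)).div_const (k a - k b)
  refine (this.congr fun x _ => ?_) a ha
  have : k a - k b ≠ 0 := by linarith
  simp only [Pi.sub_apply]
  field_simp
  ring

/-- The derivative of the kernel along a line is monotone; dividing its increment by `t` gives a
second-order condition in which a difference quotient stands in for `q''`, which is not known to
exist. All other terms have a limit. -/
theorem exists_tendsto_kernel_quotient (hK : K.OrdConnected) (ho : IsOpen K)
    (hk : ∀ a ∈ K, HasDerivAt k (1 / q a) a) (hqpos : ∀ a ∈ K, 0 < q a)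
    (hJ : KernelJensenConvex K k q) {q' : ℝ → ℝ} (hq' : ∀ a ∈ K, HasDerivAt q (q' a) a)
    (hq'c : ContinuousOn q' K) {a b : ℝ} (ha : a ∈ K) (hb : b ∈ K) (γ : ℝ) :
    ∃ w : ℝ → ℝ, Tendsto w (𝓝[>] 0) (𝓝 (-(q' a * (1 - 2 * γ) + γ ^ 2 * q' b) / q a)) ∧
      ∀ᶠ t in 𝓝[>] (0 : ℝ), 0 ≤ (k b - k a) * ((q' (a + t) - q' a) / t) + w t := by
  have hkc : ContinuousOn k K := fun x hx => (hk x hx).continuousAt.continuousWithinAt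
  have hqc : ContinuousOn q K := fun x hx => (hq' x hx).continuousAt.continuousWithinAt
  have pa := hqpos a ha
  have pb := hqpos b hb
  -- The direction `(1, β)` is rescaled so that the limit is a quadratic in `γ` with coefficients
  -- free of `q b`, apart from the common factor `1 / q a`.
  set β := γ * q b / q a with hβ
  set T : Set ℝ := {t | a + t ∈ K ∧ b + β * t ∈ K} with hT
  have hTo : IsOpen T := (ho.preimage (by fun_prop : Continuous fun t => a + t)).inter
    (ho.preimage (by fun_prop : Continuous fun t => b + β * t))
  have hTc : Convex ℝ T := by
    intro s hs t ht u v hu hv huv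
    have h1 := hK.convex hs.1 ht.1 hu hv huv
    have h2 := hK.convex hs.2 ht.2 hu hv huv
    simp only [smul_eq_mul] at h1 h2 ⊢
    constructor
    · convert h1 using 1
      linear_combination -a * huv
    · convert h2 using 1
      linear_combination -b * huv
  have h0 : (0 : ℝ) ∈ T := by simp [hT, ha, hb]
  have hconv := convexOn_kernel_line hkc hqc hJ hTc (β := β) (fun t ht => ht.1) fun t ht => ht.2
  have dA : ∀ t : ℝ, HasDerivAt (fun t => a + t) 1 t := fun t => (hasDerivAt_id t).const_add a
  have dB : ∀ t : ℝ, HasDerivAt (fun t => b + β * t) β t := fun t => by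
    simpa using ((hasDerivAt_id t).const_mul β).const_add b
  have dqA : ∀ t ∈ T, HasDerivAt (fun t => q (a + t)) (q' (a + t)) t :=
    fun t ht => (hq' _ ht.1).comp_const_add a t
  have dqB : ∀ t ∈ T, HasDerivAt (fun t => q (b + β * t)) (q' (b + β * t) * β) t :=
    fun t ht => (hq' _ ht.2).comp t (dB t)
  have dk : ∀ t ∈ T, HasDerivAt (fun t => k (b + β * t) - k (a + t))
      (1 / q (b + β * t) * β - 1 / q (a + t)) t := fun t ht =>
    ((hk _ ht.2).comp t (dB t)).sub ((hk _ ht.1).comp_const_add a t)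
  have hder : ∀ t ∈ T, HasDerivAt (fun t => q (a + t) * (k (b + β * t) - k (a + t)))
      (q' (a + t) * (k (b + β * t) - k (a + t)) +
        q (a + t) * (1 / q (b + β * t) * β - 1 / q (a + t))) t :=
    fun t ht => (dqA t ht).mul (dk t ht)
  have hmono : ∀ t ∈ T, 0 < t → q' a * (k b - k a) + q a * (1 / q b * β - 1 / q a) ≤
      q' (a + t) * (k (b + β * t) - k (a + t)) +
        q (a + t) * (1 / q (b + β * t) * β - 1 / q (a + t)) := by
    intro t ht htpos
    have := hconv.monotoneOn_deriv (fun x hx => (hder x hx).differentiableAt) h0 ht htpos.le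
    rw [(hder 0 h0).deriv, (hder t ht).deriv] at this
    simpa using this
  have dquot : HasDerivAt (fun t => β * (q (a + t) / q (b + β * t)))
      (β * ((q' (a + 0) * q (b + β * 0) - q (a + 0) * (q' (b + β * 0) * β)) /
        q (b + β * 0) ^ 2)) 0 :=
    ((dqA 0 h0).div (dqB 0 h0) (hqpos _ h0.2).ne').const_mul β
  have hIoi : 𝓝[>] (0 : ℝ) ≤ 𝓝[≠] 0 := nhdsWithin_mono 0 fun t ht => ne_of_gt ht
  have s1 := (hasDerivAt_iff_tendsto_slope_zero.1 (dk 0 h0)).mono_left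
    hIoi
  have s2 := (hasDerivAt_iff_tendsto_slope_zero.1 dquot).mono_left
    hIoi
  have s3 : Tendsto (fun t => q' (a + t)) (𝓝[>] 0) (𝓝 (q' a)) := by
    have h1 : ContinuousAt q' (a + 0) := by
      rw [add_zero]
      exact hq'c.continuousAt (ho.mem_nhds ha)
    have := (h1.comp (f := fun t => a + t) (dA 0).continuousAt).tendsto
    simp only [Function.comp_def, add_zero] at this
    exact this.mono_left nhdsWithin_le_nhds
  simp only [zero_add, mul_zero, add_zero, smul_eq_mul] at s1 s2
  refine ⟨fun t => q' (a + t) * (t⁻¹ * (k (b + β * t) - k (a + t) - (k b - k a))) +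
    t⁻¹ * (β * (q (a + t) / q (b + β * t)) - β * (q a / q b)), ?_, ?_⟩
  · convert (s3.mul s1).add s2 using 2
    rw [hβ]
    field_simp
    ring
  · have hTev : ∀ᶠ t in 𝓝[>] (0 : ℝ), t ∈ T := nhdsWithin_le_nhds (hTo.mem_nhds h0)
    filter_upwards [hTev, self_mem_nhdsWithin] with t ht htpos
    have htpos' : 0 < t := htpos
    have key := hmono t ht htpos
    have p1 := hqpos _ ht.1
    have p2 := hqpos _ ht.2
    have e : (k b - k a) * ((q' (a + t) - q' a) / t) +
        (q' (a + t) * (t⁻¹ * (k (b + β * t) - k (a + t) - (k b - k a))) +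
         t⁻¹ * (β * (q (a + t) / q (b + β * t)) - β * (q a / q b))) =
        t⁻¹ * ((q' (a + t) * (k (b + β * t) - k (a + t)) +
        q (a + t) * (1 / q (b + β * t) * β - 1 / q (a + t))) -
          (q' a * (k b - k a) + q a * (1 / q b * β - 1 / q a))) := by
      field_simp
      ring
    refine le_of_le_of_eq ?_ e.symm
    exact mul_nonneg (by positivity) (by linarith)

/-- The three-point inequality satisfied by the derivative of `q` when the kernel
`(a, b) ↦ q a * (k b - k a)` with `k' = 1 / q` is jointly convex. -/
theorem kernel_three_point (hK : K.OrdConnected) (ho : IsOpen K) (hkm : StrictMonoOn k K)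
    (hk : ∀ a ∈ K, HasDerivAt k (1 / q a) a) (hqpos : ∀ a ∈ K, 0 < q a)
    (hJ : KernelJensenConvex K k q) {q' : ℝ → ℝ} (hq' : ∀ a ∈ K, HasDerivAt q (q' a) a)
    (hq'c : ContinuousOn q' K) {a b c : ℝ} (ha : a ∈ K) (hb : b ∈ K) (hc : c ∈ K) (hba : b < a)
    (hac : a < c) (γ δ : ℝ) :
    0 ≤ (k a - k b) * (-q' a * (1 - 2 * γ) + γ ^ 2 * -q' c) +
      (k c - k a) * (-q' a * (1 - 2 * δ) + δ ^ 2 * -q' b) := by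
  obtain ⟨w₁, hw₁, hw₁'⟩ := exists_tendsto_kernel_quotient hK ho hk hqpos hJ hq' hq'c ha hc γ
  obtain ⟨w₂, hw₂, hw₂'⟩ := exists_tendsto_kernel_quotient hK ho hk hqpos hJ hq' hq'c ha hb δ
  have p1 : 0 < k a - k b := sub_pos.2 (hkm hb ha hba)
  have p2 : 0 < k c - k a := sub_pos.2 (hkm ha hc hac)
  have pa := hqpos a ha
  -- Since `b < a < c`, the quotient of `q'` carries factors of opposite sign in the two
  -- inequalities; these positive weights cancel it, and the limit can be taken.
  have hlim := (hw₁.const_mul (k a - k b)).add (hw₂.const_mul (k c - k a))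
  have hge : ∀ᶠ t in 𝓝[>] (0 : ℝ), 0 ≤ (k a - k b) * w₁ t + (k c - k a) * w₂ t := by
    filter_upwards [hw₁', hw₂'] with t h1 h2
    have h1' := mul_nonneg p1.le h1
    have h2' := mul_nonneg p2.le h2
    linarith
  have := ge_of_tendsto hlim hge
  have h3 := mul_nonneg this pa.le
  have e : ((k a - k b) * (-(q' a * (1 - 2 * γ) + γ ^ 2 * q' c) / q a) +
      (k c - k a) * (-(q' a * (1 - 2 * δ) + δ ^ 2 * q' b) / q a)) * q a =
      (k a - k b) * (-q' a * (1 - 2 * γ) + γ ^ 2 * -q' c) +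
      (k c - k a) * (-q' a * (1 - 2 * δ) + δ ^ 2 * -q' b) := by
    field_simp
    ring
  rwa [e] at h3

end Kernel

/-! ### From the three-point inequality to concavity of the reciprocal -/

section ReciprocalConcave

/-- A nonnegative function satisfying the three-point inequality is either identically zero, or
positive with concave reciprocal. -/
theorem eq_zero_or_concaveOn_inv {I : Set ℝ} (hI : I.OrdConnected) (ho : IsOpen I) {ρ : ℝ → ℝ}
    (h0 : ∀ x ∈ I, 0 ≤ ρ x)
    (h3 : ∀ x ∈ I, ∀ y ∈ I, ∀ z ∈ I, y < x → x < z → ∀ γ δ : ℝ,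
      0 ≤ (x - y) * (ρ x * (1 - 2 * γ) + γ ^ 2 * ρ z) +
        (z - x) * (ρ x * (1 - 2 * δ) + δ ^ 2 * ρ y)) :
    (∀ x ∈ I, ρ x = 0) ∨ ((∀ x ∈ I, 0 < ρ x) ∧ ConcaveOn ℝ I (fun x => 1 / ρ x)) := by
  by_cases hz : ∀ x ∈ I, ρ x = 0
  · exact Or.inl hz
  push Not at hz
  obtain ⟨x, hx, hρx⟩ := hz
  have hxpos : 0 < ρ x := lt_of_le_of_ne (h0 x hx) hρx.symm
  have hpos : ∀ y ∈ I, 0 < ρ y := by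
    intro y hy
    refine lt_of_le_of_ne (h0 y hy) fun hy0 => ?_
    rcases lt_trichotomy y x with hlt | rfl | hlt
    · obtain ⟨z, hz, hxz⟩ := exists_gt_mem_of_isOpen ho hx
      have p1 : 0 < x - y := sub_pos.2 hlt
      have p2 : 0 < z - x := sub_pos.2 hxz
      -- When `ρ y = 0` the expression is affine in `δ` and unbounded below; this `δ` makes it
      -- negative.
      have := h3 x hx y hy z hz hlt hxz 0 ((x - y) / (z - x) + 1)
      rw [← hy0] at this
      have e : (x - y) * (ρ x * (1 - 2 * 0) + 0 ^ 2 * ρ z) +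
        (z - x) * (ρ x * (1 - 2 * ((x - y) / (z - x) + 1)) + ((x - y) / (z - x) + 1) ^ 2 * 0) =
        -(ρ x * ((x - y) + (z - x))) := by field_simp; ring
      rw [e] at this
      have := mul_pos hxpos (add_pos p1 p2)
      linarith
    · exact hρx hy0.symm
    · obtain ⟨z, hz, hzx⟩ := exists_lt_mem_of_isOpen ho hx
      have p1 : 0 < y - x := sub_pos.2 hlt
      have p2 : 0 < x - z := sub_pos.2 hzx
      have := h3 x hx z hz y hy hzx hlt ((y - x) / (x - z) + 1) 0
      rw [← hy0] at this
      have e : (x - z) * (ρ x * (1 - 2 * ((y - x) / (x - z) + 1)) + ((y - x) / (x - z) + 1) ^ 2 * 0)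
        + (y - x) * (ρ x * (1 - 2 * 0) + 0 ^ 2 * ρ z) =
        -(ρ x * ((x - z) + (y - x))) := by field_simp; ring
      rw [e] at this
      have := mul_pos hxpos (add_pos p2 p1)
      linarith
  refine Or.inr ⟨hpos, concaveOn_of_slope_anti_adjacent hI.convex fun {y x z} hy hz hyx hxz => ?_⟩
  have hx := hI.out hy hz ⟨hyx.le, hxz.le⟩
  have q1 := hpos x hx
  have q2 := hpos y hy
  have q3 := hpos z hz
  have p1 : 0 < x - y := sub_pos.2 hyx
  have p2 : 0 < z - x := sub_pos.2 hxz
  -- These values minimise the two quadratics in `γ` and `δ`.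
  have := h3 x hx y hy z hz hyx hxz (ρ x / ρ z) (ρ x / ρ y)
  have e : (x - y) * (ρ x * (1 - 2 * (ρ x / ρ z)) + (ρ x / ρ z) ^ 2 * ρ z) +
        (z - x) * (ρ x * (1 - 2 * (ρ x / ρ y)) + (ρ x / ρ y) ^ 2 * ρ y) =
      ρ x ^ 2 * ((1 / ρ x - 1 / ρ y) * (z - x) - (1 / ρ z - 1 / ρ x) * (x - y)) := by
    field_simp
    ring
  rw [e] at this
  have := nonneg_of_mul_nonneg_right this (pow_pos q1 2)
  rw [div_le_div_iff₀ p2 p1]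
  linarith

end ReciprocalConcave

/-! ### Regularity of generators of Jensen concave means -/

section Necessity

variable {I : Set ℝ} {h : ℝ → ℝ}

/-- In the coordinates `a = h x`, `b = h u`, this is exactly the tangent inequality. -/
theorem kernelJensenConvex_of_mean2 (hI : I.OrdConnected) (ho : IsOpen I)
    (hc : ContinuousOn h I) (hm : StrictMonoOn h I) (hJ : Mean2JensenConcave I h) {d : ℝ → ℝ}
    (hd : ∀ x ∈ I, HasDerivAt h (d x) x) (hpos : ∀ x ∈ I, 0 < d x) :
    KernelJensenConvex (h '' I) (Function.invFunOn h I) (fun a => d (Function.invFunOn h I a)) := by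
  intro a ha b hb a' ha' b' hb'
  have := tangent_le_of_mean2 hI ho hc hm hJ hd hpos (invFunOn_mem_of_image ha)
    (invFunOn_mem_of_image ha') (invFunOn_mem_of_image hb) (invFunOn_mem_of_image hb')
  rwa [mean2_eq_invFunOn, mean2_eq_invFunOn, apply_invFunOn ha, apply_invFunOn ha',
    apply_invFunOn hb, apply_invFunOn hb'] at this

/-- On an open interval, the generator of a Jensen concave two-variable quasiarithmetic mean is
twice differentiable with `h' > 0`, and either `h'' = 0` or `-h' / h''` is positive and concave. -/
theorem exists_deriv_of_mean2JensenConcave (hI : I.OrdConnected) (ho : IsOpen I)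
    (hc : ContinuousOn h I) (hm : StrictMonoOn h I) (hJ : Mean2JensenConcave I h) :
    ∃ d ρ : ℝ → ℝ, (∀ x ∈ I, HasDerivAt h (d x) x) ∧ (∀ x ∈ I, 0 < d x) ∧
      (∀ x ∈ I, HasDerivAt d (-ρ x * d x) x) ∧
      ((∀ x ∈ I, ρ x = 0) ∨ ((∀ x ∈ I, 0 < ρ x) ∧ ConcaveOn ℝ I (fun x => 1 / ρ x))) := by
  have hex : ∀ x ∈ I, ∃ d, 0 < d ∧ HasDerivAt h d x := fun x hx =>
    exists_hasDerivAt_of_mean2 hI ho hc hm hJ hx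
  have hd : ∀ x ∈ I, HasDerivAt h (deriv h x) x := fun x hx => by
    obtain ⟨d, -, h1⟩ := hex x hx
    exact h1.differentiableAt.hasDerivAt
  have hpos : ∀ x ∈ I, 0 < deriv h x := fun x hx => by
    obtain ⟨d, h0, h1⟩ := hex x hx
    rwa [h1.deriv]
  have hconc := concaveOn_of_mean2 hI hc hm hJ
  have hanti : AntitoneOn (deriv h) I :=
    hconc.antitoneOn_deriv fun x hx => (hd x hx).differentiableAt
  have hdc : ContinuousOn (deriv h) I := by
    have := continuousOn_of_hasDerivAt_of_monotoneOn hI ho (φ := fun x => -h x)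
      (φ' := fun x => -deriv h x) (fun x hx => (hd x hx).neg)
      fun x hx y hy hxy => neg_le_neg (hanti hx hy hxy)
    exact this.neg.congr fun x _ => (neg_neg _).symm
  set K := h '' I with hKdef
  set k := Function.invFunOn h I with hkdef
  set q : ℝ → ℝ := fun a => deriv h (k a) with hqdef
  have hK : K.OrdConnected := ordConnected_image hI hc
  have hKo : IsOpen K := isOpen_image hI ho hc hm
  have hkm : StrictMonoOn k K := strictMonoOn_invFunOn hm
  have hkc : ContinuousOn k K := continuousOn_invFunOn hI hc hm
  have hkI : ∀ a ∈ K, k a ∈ I := fun a ha => invFunOn_mem_of_image ha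
  have hkh : ∀ x ∈ I, k (h x) = x := fun x hx => invFunOn_apply hm.injOn hx
  have hqpos : ∀ a ∈ K, 0 < q a := fun a ha => hpos _ (hkI a ha)
  have hqc : ContinuousOn q K := hdc.comp hkc hkI
  have hk : ∀ a ∈ K, HasDerivAt k (1 / q a) a := by
    rintro _ ⟨x, hx, rfl⟩
    have := hasDerivAt_invFunOn hI hc hm (by rwa [ho.interior_eq]) (hd x hx) (hpos x hx).ne'
    simp only [hqdef, hkh x hx]
    exact this
  have hker : KernelJensenConvex K k q := kernelJensenConvex_of_mean2 hI ho hc hm hJ hd hpos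
  have hq' : ∀ a ∈ K, HasDerivAt q (deriv q a) a := fun a ha => by
    obtain ⟨q', h1⟩ := exists_hasDerivAt_kernel hK hKo hkm hk hqc hker ha
    exact h1.differentiableAt.hasDerivAt
  have hq'c := continuousOn_deriv_kernel hK hKo hkm hk hker hq'
  have hq'0 : ∀ a ∈ K, deriv q a ≤ 0 := by
    intro a ha
    have hqa : AntitoneOn q K := fun s hs t ht hst =>
      hanti (hkI s hs) (hkI t ht) (hkm.monotoneOn hs ht hst)
    have := hqa.derivWithin_nonpos (x := a)
    rwa [derivWithin_of_isOpen hKo ha] at this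
  -- From `h' = q ∘ h` one gets `h'' = (q' ∘ h) * h'`, so this `ρ` is `-h'' / h'`.
  refine ⟨deriv h, fun x => -deriv q (h x), hd, hpos, fun x hx => ?_, ?_⟩
  · have h1 := (hq' (h x) (mem_image_of_mem h hx)).comp x (hd x hx)
    rw [neg_neg]
    refine h1.congr_of_eventuallyEq ?_
    filter_upwards [ho.mem_nhds hx] with t ht
    simp only [hqdef, Function.comp_apply, hkh t ht]
  · refine eq_zero_or_concaveOn_inv hI ho (fun x hx => neg_nonneg.2 (hq'0 _ (mem_image_of_mem h hx)))
      fun x hx y hy z hz hyx hxz γ δ => ?_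
    have := kernel_three_point hK hKo hkm hk hqpos hker hq' hq'c (mem_image_of_mem h hx)
      (mem_image_of_mem h hy) (mem_image_of_mem h hz) (hm hy hx hyx) (hm hx hz hxz) γ δ
    rwa [hkh x hx, hkh y hy, hkh z hz] at this

end Necessity

/-! ### Primitives on an interval, endpoints included -/

section Primitive

theorem hasDerivWithinAt_integral {I : Set ℝ} (hI : I.OrdConnected) {p : ℝ → ℝ}
    (hp : ContinuousOn p I) {c x : ℝ} (hc : c ∈ I) (hx : x ∈ I) :
    HasDerivWithinAt (fun y => ∫ t in c..y, p t) (p x) I x := by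
  have hint : ∀ a ∈ I, ∀ b ∈ I, IntervalIntegrable p MeasureTheory.volume a b := fun a ha b hb =>
    (hp.mono (hI.uIcc_subset ha hb)).intervalIntegrable
  rw [hasDerivWithinAt_iff_isLittleO, Asymptotics.isLittleO_iff]
  intro ε hε
  obtain ⟨δ, hδ, hclose⟩ := Metric.continuousWithinAt_iff.1 (hp x hx) ε hε
  filter_upwards [self_mem_nhdsWithin, nhdsWithin_le_nhds (Metric.ball_mem_nhds x hδ)] with y hy hyb
  have e : (∫ t in c..y, p t) - (∫ t in c..x, p t) - (y - x) • p x = ∫ t in x..y, (p t - p x) := by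
    rw [intervalIntegral.integral_interval_sub_left (hint c hc y hy) (hint c hc x hx),
      intervalIntegral.integral_sub (hint x hx y hy) (by simp), intervalIntegral.integral_const]
  rw [e, Real.norm_eq_abs (y - x)]
  refine intervalIntegral.norm_integral_le_of_norm_le_const fun t ht => ?_
  have ht' := uIoc_subset_uIcc ht
  have hball := (convex_ball x δ).ordConnected.uIcc_subset (Metric.mem_ball_self hδ) hyb ht'
  exact (hclose (hI.uIcc_subset hx hy ht') hball).le

end Primitive

/-! ### Convex envelopes and subgradients -/

section Envelope

variable {I : Set ℝ}

theorem le_chord_of_convexOn {ψ : ℝ → ℝ} (hψ : ConvexOn ℝ I ψ) {x c y : ℝ} (hx : x ∈ I)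
    (hc : c ∈ I) (hxc : c - x ≠ 0) (h0 : 0 ≤ (y - x) / (c - x)) (h1 : (y - x) / (c - x) ≤ 1) :
    ψ y ≤ ψ x + (y - x) / (c - x) * (ψ c - ψ x) := by
  have := hψ.2 hx hc (sub_nonneg.2 h1) h0 (by ring)
  simp only [smul_eq_mul] at this
  have e : (1 - (y - x) / (c - x)) * x + (y - x) / (c - x) * c = y := by
    field_simp
    ring
  rw [e] at this
  linarith

/-- Convex functions on an interval are upper semicontinuous. -/
theorem eventually_lt_of_convexOn {ψ : ℝ → ℝ} (hψ : ConvexOn ℝ I ψ) {x a : ℝ} (hx : x ∈ I)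
    (ha : ψ x < a) : ∀ᶠ y in 𝓝[I] x, ψ y < a := by
  -- The chord through `c` bounds `ψ` between `x` and `c`. For `c = x` the quotient is `0` by
  -- convention, so no condition on `c` is needed. On a side of `x` without points of `I`, only `y =
  -- x` is left to treat.
  have hB : ∀ c, ∀ᶠ y in 𝓝 x, ψ x + (y - x) / (c - x) * (ψ c - ψ x) < a := fun c => by
    have : ContinuousAt (fun y => ψ x + (y - x) / (c - x) * (ψ c - ψ x)) x := by fun_prop
    refine this.eventually_lt continuousAt_const ?_
    simpa using ha
  have hright : ∀ᶠ y in 𝓝 x, y ∈ I → x ≤ y → ψ y < a := by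
    by_cases h : ∃ c ∈ I, x < c
    · obtain ⟨c, hc, hxc⟩ := h
      filter_upwards [hB c, Iic_mem_nhds hxc] with y hy hyc _ hxy
      have p : 0 < c - x := sub_pos.2 hxc
      have hyc' : y ≤ c := hyc
      exact (le_chord_of_convexOn hψ hx hc p.ne' (div_nonneg (by linarith) p.le)
        ((div_le_one p).2 (by linarith))).trans_lt hy
    · push Not at h
      exact Eventually.of_forall fun y hy hxy => le_antisymm hxy (h y hy) ▸ ha
  have hleft : ∀ᶠ y in 𝓝 x, y ∈ I → y ≤ x → ψ y < a := by
    by_cases h : ∃ c ∈ I, c < x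
    · obtain ⟨c, hc, hxc⟩ := h
      filter_upwards [hB c, Ici_mem_nhds hxc] with y hy hyc _ hxy
      have p : c - x < 0 := sub_neg.2 hxc
      have hyc' : c ≤ y := hyc
      exact (le_chord_of_convexOn hψ hx hc p.ne
        (div_nonneg_of_nonpos (by linarith) p.le)
        ((div_le_one_of_neg p).2 (by linarith))).trans_lt hy
    · push Not at h
      exact Eventually.of_forall fun y hy hxy => le_antisymm (h y hy) hxy ▸ ha
  rw [eventually_nhdsWithin_iff]
  filter_upwards [hright, hleft] with y h1 h2 hy
  rcases le_total x y with h | h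
  exacts [h1 hy h, h2 hy h]

/-- If there is a continuous Jensen convex minorant, then the convex envelope is attained by a
continuous convex function. -/
theorem exists_eq_convexEnvelopeC (hI : I.OrdConnected) {φ u₀ : ℝ → ℝ} (h₀ : ContinuousOn u₀ I)
    (hJ₀ : JensenConvexOn I u₀) (hle₀ : ∀ x ∈ I, u₀ x ≤ φ x) :
    ∃ ψ : ℝ → ℝ, ContinuousOn ψ I ∧ ConvexOn ℝ I ψ ∧ (∀ x ∈ I, ψ x ≤ φ x) ∧
      (∀ u : ℝ → ℝ, ContinuousOn u I → JensenConvexOn I u → (∀ x ∈ I, u x ≤ φ x) →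
        ∀ x ∈ I, u x ≤ ψ x) ∧
      ∀ x ∈ I, convexEnvelopeC I φ x = ψ x := by
  set S : Set (ℝ → ℝ) := {u | ContinuousOn u I ∧ JensenConvexOn I u ∧ ∀ x ∈ I, u x ≤ φ x} with hS
  have hSne : S.Nonempty := ⟨u₀, h₀, hJ₀, hle₀⟩
  set ψ : ℝ → ℝ := fun x => sSup ((fun u => u x) '' S) with hψdef
  have hne : ∀ x, ((fun u : ℝ → ℝ => u x) '' S).Nonempty := fun x => hSne.image _
  have hbdd : ∀ x ∈ I, BddAbove ((fun u : ℝ → ℝ => u x) '' S) := by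
    rintro x hx
    refine ⟨φ x, ?_⟩
    rintro _ ⟨u, hu, rfl⟩
    exact hu.2.2 x hx
  have hle : ∀ u ∈ S, ∀ x ∈ I, u x ≤ ψ x := fun u hu x hx =>
    le_csSup (hbdd x hx) (mem_image_of_mem _ hu)
  have hψφ : ∀ x ∈ I, ψ x ≤ φ x := by
    intro x hx
    refine csSup_le (hne x) ?_
    rintro _ ⟨u, hu, rfl⟩
    exact hu.2.2 x hx
  have hconv : ConvexOn ℝ I ψ := by
    refine ⟨hI.convex, fun x hx y hy a b ha hb hab => csSup_le (hne _) ?_⟩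
    rintro _ ⟨u, hu, rfl⟩
    refine ((hu.2.1.convexOn hI hu.1).2 hx hy ha hb hab).trans ?_
    exact add_le_add (smul_le_smul_of_nonneg_left (hle u hu x hx) ha)
      (smul_le_smul_of_nonneg_left (hle u hu y hy) hb)
  -- Lower semicontinuity comes from being a supremum of continuous functions, upper semicontinuity
  -- from convexity, even at endpoints.
  have hcont : ContinuousOn ψ I := by
    intro x hx
    refine tendsto_order.2 ⟨fun a ha => ?_, fun a ha => eventually_lt_of_convexOn hconv hx ha⟩
    obtain ⟨_, ⟨u, hu, rfl⟩, hau⟩ := exists_lt_of_lt_csSup (hne x) ha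
    filter_upwards [(tendsto_order.1 (hu.1 x hx)).1 a hau, self_mem_nhdsWithin] with y h1 h2
    exact h1.trans_le (hle u hu y h2)
  refine ⟨ψ, hcont, hconv, hψφ, fun u h1 h2 h3 x hx => hle u ⟨h1, h2, h3⟩ x hx, fun x hx => ?_⟩
  refine le_antisymm (sSup_le ?_) (le_sSup ⟨ψ, ⟨hcont, jensenConvexOn_of_convexOn hconv⟩, hψφ, rfl⟩)
  rintro _ ⟨u, ⟨h1, h2⟩, h3, rfl⟩
  exact EReal.coe_le_coe_iff.2 (hle u ⟨h1, h2, h3⟩ x hx)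

theorem exists_subgradient {s : Set ℝ} {u : ℝ → ℝ} (hu : ConvexOn ℝ s u) {y : ℝ}
    (hy : y ∈ interior s) : ∃ σ : ℝ, ∀ x ∈ s, u y + σ * (x - y) ≤ u x := by
  have hr := (hu.differentiableWithinAt_Ioi_of_mem_interior hy).hasDerivWithinAt
  have hl := (hu.differentiableWithinAt_Iio_of_mem_interior hy).hasDerivWithinAt
  have hlr := leftDeriv_le_rightDeriv_of_convexOn hu hy hr hl
  have hys := interior_subset hy
  refine ⟨derivWithin u (Ioi y) y, fun x hx => ?_⟩
  rcases lt_trichotomy x y with h | rfl | h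
  · have h1 := (hu.slope_le_of_hasDerivWithinAt_Iio hx hys h hl).trans hlr
    rw [slope_def_field, div_le_iff₀ (sub_pos.2 h)] at h1
    linarith
  · simp
  · have h1 := hu.le_slope_of_hasDerivWithinAt_Ioi hys hx h hr
    rw [slope_def_field, le_div_iff₀ (sub_pos.2 h)] at h1
    linarith

theorem upperEnvelope_eq {α : Type*} {D : Set α} {S : Set (α → ℝ)} {F M : α → ℝ} (hM : M ∈ S)
    (hle : ∀ z ∈ D, F z ≤ M z) {p : α}
    (hmin : ∀ N ∈ S, (∀ z ∈ D, F z ≤ N z) → M p ≤ N p) :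
    upperEnvelope D S F p = (M p : EReal) := by
  refine le_antisymm (sInf_le ⟨M, hM, hle, rfl⟩) (le_sInf ?_)
  rintro _ ⟨N, hN, h, rfl⟩
  exact EReal.coe_le_coe_iff.2 (hmin N hN h)

end Envelope

/-! ### Derivatives of `C²` generators -/

section Generators

variable {I : Set ℝ} {f : ℝ → ℝ}

theorem uniqueDiffOn_interval (hI : I.OrdConnected) (hI' : I.Nontrivial) : UniqueDiffOn ℝ I :=
  uniqueDiffOn_convex hI.convex (nonempty_interior_of_nontrivial hI hI')

theorem IsC2Sharp.contDiffOn_deriv1 (hI : I.OrdConnected) (hI' : I.Nontrivial)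
    (hf : IsC2Sharp I f) : ContDiffOn ℝ 1 (deriv1 I f) I :=
  hf.1.derivWithin (uniqueDiffOn_interval hI hI') (by norm_num)

theorem IsC2Sharp.hasDerivWithinAt (hf : IsC2Sharp I f) {x : ℝ} (hx : x ∈ I) :
    HasDerivWithinAt f (deriv1 I f x) I x :=
  (hf.1.differentiableOn (by norm_num) x hx).hasDerivWithinAt

theorem IsC2Sharp.hasDerivWithinAt_deriv1 (hI : I.OrdConnected) (hI' : I.Nontrivial)
    (hf : IsC2Sharp I f) {x : ℝ} (hx : x ∈ I) :
    HasDerivWithinAt (deriv1 I f) (deriv2 I f x) I x :=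
  ((hf.contDiffOn_deriv1 hI hI').differentiableOn (by norm_num) x hx).hasDerivWithinAt

theorem IsC2Sharp.continuousOn_deriv2 (hI : I.OrdConnected) (hI' : I.Nontrivial)
    (hf : IsC2Sharp I f) : ContinuousOn (deriv2 I f) I :=
  (hf.contDiffOn_deriv1 hI hI').continuousOn_derivWithin (uniqueDiffOn_interval hI hI')
    (by norm_num)

theorem IsC2Sharp.deriv1_pos (hf : IsC2Sharp I f) (hmono : MonotoneOn f I) {x : ℝ} (hx : x ∈ I) :
    0 < deriv1 I f x :=
  lt_of_le_of_ne hmono.derivWithin_nonneg (hf.2 x hx).symm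

theorem IsC2Sharp.deriv2_nonpos (hf : IsC2Sharp I f) (hconc : ConcaveOn ℝ I f) (x : ℝ) :
    deriv2 I f x ≤ 0 :=
  (hconc.antitoneOn_derivWithin (hf.1.differentiableOn (by norm_num))).derivWithin_nonpos

theorem deriv1_eq (hI : I.OrdConnected) (hI' : I.Nontrivial) {g G : ℝ → ℝ}
    (hg : ∀ x ∈ I, HasDerivWithinAt g (G x) I x) {x : ℝ} (hx : x ∈ I) : deriv1 I g x = G x :=
  (hg x hx).derivWithin (uniqueDiffOn_interval hI hI' x hx)

theorem deriv2_eq (hI : I.OrdConnected) (hI' : I.Nontrivial) {g G G' : ℝ → ℝ}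
    (hg : ∀ x ∈ I, HasDerivWithinAt g (G x) I x) (hG : ∀ x ∈ I, HasDerivWithinAt G (G' x) I x)
    {x : ℝ} (hx : x ∈ I) : deriv2 I g x = G' x :=
  deriv1_eq hI hI' (g := deriv1 I g) (G := G') (fun y hy => (hG y hy).congr
    (fun _ hz => deriv1_eq hI hI' hg hz) (deriv1_eq hI hI' hg hy)) hx

theorem isC2Sharp_of_hasDerivWithinAt (hI : I.OrdConnected) (hI' : I.Nontrivial)
    {g G G' : ℝ → ℝ} (hg : ∀ x ∈ I, HasDerivWithinAt g (G x) I x)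
    (hG : ∀ x ∈ I, HasDerivWithinAt G (G' x) I x) (hG' : ContinuousOn G' I)
    (h0 : ∀ x ∈ I, G x ≠ 0) : IsC2Sharp I g := by
  have hu := uniqueDiffOn_interval hI hI'
  refine ⟨?_, fun x hx => by rw [deriv1_eq hI hI' hg hx]; exact h0 x hx⟩
  have h1 : ContDiffOn ℝ 1 G I := by
    rw [show (1 : WithTop ℕ∞) = 0 + 1 by norm_num, contDiffOn_succ_iff_derivWithin hu]
    refine ⟨fun x hx => (hG x hx).differentiableWithinAt, by simp, contDiffOn_zero.2 ?_⟩
    exact hG'.congr fun x hx => deriv1_eq hI hI' hG hx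
  rw [show (2 : WithTop ℕ∞) = 1 + 1 by norm_num, contDiffOn_succ_iff_derivWithin hu]
  exact ⟨fun x hx => (hg x hx).differentiableWithinAt, by simp,
    h1.congr fun x hx => deriv1_eq hI hI' hg hx⟩

end Generators

/-! ### Jensen concave means above the mean generated by `f` -/

section Competitors

variable {I : Set ℝ} {f : ℝ → ℝ} {N : Tuple → ℝ}

theorem exists_strictMonoOn_generator (hI : I.OrdConnected) (hN : N ∈ quasiarithmeticMeans I) :
    ∃ h : ℝ → ℝ, ContinuousOn h I ∧ StrictMonoOn h I ∧ ∀ p ∈ tuples I, N p = qaMean I h p := by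
  obtain ⟨h, hc, hm | hm, hN⟩ := hN
  · exact ⟨h, hc, hm, hN⟩
  · refine ⟨fun x => -h x, hc.neg, fun x hx y hy hxy => neg_lt_neg (hm hx hy hxy), fun p hp => ?_⟩
    rw [hN p hp, qaMean_neg hI hc hm.injOn hp]

theorem mean2JensenConcave_of_isJensenConcaveMean (hN : IsJensenConcaveMean I N)
    (hI : I.OrdConnected) {h : ℝ → ℝ} (hNh : ∀ p ∈ tuples I, N p = qaMean I h p) :
    Mean2JensenConcave I h := by
  intro x hx y hy x' hx' y' hy'
  have := hN 2 (by norm_num) ![x, y] (pair_mem_tuples hx hy).2 ![x', y']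
    (pair_mem_tuples hx' hy').2
  have e : (2⁻¹ : ℝ) • (![x, y] + ![x', y']) = ![(x + x') / 2, (y + y') / 2] := by
    ext i
    fin_cases i <;> simp [inv_mul_eq_div]
  rw [e] at this
  simp only at this
  rwa [hNh _ (pair_mem_tuples hx hy), hNh _ (pair_mem_tuples hx' hy'),
    hNh _ (pair_mem_tuples (avg2_mem hI hx hx') (avg2_mem hI hy hy'))] at this

/-- Shrinking the interval does not change the mean, so the regularity results for open intervals
apply. -/
theorem mean2JensenConcave_interior {h : ℝ → ℝ} (hI : I.OrdConnected) (hc : ContinuousOn h I)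
    (hm : StrictMonoOn h I) (hJ : Mean2JensenConcave I h) :
    Mean2JensenConcave (interior I) h := by
  have hJo : (interior I).OrdConnected := hI.convex.interior.ordConnected
  have e : ∀ x ∈ interior I, ∀ y ∈ interior I, mean2 (interior I) h x y = mean2 I h x y := by
    intro x hx y hy
    exact (mean2_eq hm (interior_subset (mean2_mem hJo (hc.mono interior_subset) hx hy))
      (apply_mean2 hJo (hc.mono interior_subset) hx hy)).symm
  intro x hx y hy x' hx' y' hy'
  rw [e x hx y hy, e x' hx' y' hy', e _ (avg2_mem hJo hx hx') _ (avg2_mem hJo hy hy')]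
  exact hJ x (interior_subset hx) y (interior_subset hy) x' (interior_subset hx') y'
    (interior_subset hy')

/-- The structure of the Jensen concave quasiarithmetic means above the mean generated by `f`. -/
theorem exists_generator_of_competitor (hI : I.OrdConnected) (hI' : I.Nontrivial)
    (hf : IsC2Sharp I f) (hmono : MonotoneOn f I) (hN : N ∈ quasiarithmeticMeans I)
    (hNJ : IsJensenConcaveMean I N) (hfN : ∀ p ∈ tuples I, qaMean I f p ≤ N p) :
    ∃ h d ρ : ℝ → ℝ, ContinuousOn h I ∧ StrictMonoOn h I ∧
      (∀ p ∈ tuples I, N p = qaMean I h p) ∧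
      (∀ x ∈ interior I, HasDerivAt h (d x) x) ∧ (∀ x ∈ interior I, 0 < d x) ∧
      (∀ x ∈ interior I, HasDerivAt d (-ρ x * d x) x) ∧
      (∀ x ∈ interior I, deriv2 I f x ≤ -ρ x * deriv1 I f x) ∧
      ((∀ x ∈ interior I, ρ x = 0) ∨
        ((∀ x ∈ interior I, 0 < ρ x) ∧ ConcaveOn ℝ (interior I) (fun x => 1 / ρ x))) := by
  obtain ⟨h, hc, hm, hNh⟩ := exists_strictMonoOn_generator hI hN
  have hJ := mean2JensenConcave_interior hI hc hm
    (mean2JensenConcave_of_isJensenConcaveMean hNJ hI hNh)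
  obtain ⟨d, ρ, hd, hpos, hdd, hρ⟩ := exists_deriv_of_mean2JensenConcave
    hI.convex.interior.ordConnected isOpen_interior (hc.mono interior_subset)
    (hm.mono interior_subset) hJ
  refine ⟨h, d, ρ, hc, hm, hNh, hd, hpos, hdd, fun x hx => ?_, hρ⟩
  have hfd : ∀ x ∈ interior I, HasDerivAt f (deriv1 I f x) x := fun x hx =>
    (hf.hasDerivWithinAt (interior_subset hx)).hasDerivAt (mem_interior_iff_mem_nhds.1 hx)
  have hfdd : ∀ x ∈ interior I, HasDerivAt (deriv1 I f) (deriv2 I f x) x := fun x hx =>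
    (hf.hasDerivWithinAt_deriv1 hI hI' (interior_subset hx)).hasDerivAt
      (mem_interior_iff_mem_nhds.1 hx)
  have hfm := strictMonoOn_of_hasDerivWithinAt_pos hI (fun x hx => hf.hasDerivWithinAt hx)
    fun x hx => hf.deriv1_pos hmono hx
  have := deriv_mul_le_of_qaMean_le hI hf.1.continuousOn hc hfm hm hfd hd hfdd hdd
    (fun x hx => hf.deriv1_pos hmono (interior_subset hx))
    (fun p hp => hNh p hp ▸ hfN p hp) x hx
  refine le_of_mul_le_mul_right ?_ (hpos x hx)
  linarith

/-- If the generator of a competitor has nonvanishing second derivative, then so has `f`, and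
`f' / f''` has affine minorants touching `h' / h''`. -/
theorem exists_affine_minorant (hI : I.OrdConnected) (hI' : I.Nontrivial)
    (hf : IsC2Sharp I f) (hmono : MonotoneOn f I) (hconc : ConcaveOn ℝ I f) {ρ : ℝ → ℝ}
    (hle : ∀ x ∈ interior I, deriv2 I f x ≤ -ρ x * deriv1 I f x)
    (hρ : ∀ x ∈ interior I, 0 < ρ x) (hρc : ConcaveOn ℝ (interior I) (fun x => 1 / ρ x))
    {y : ℝ} (hy : y ∈ interior I) :
    (∀ x ∈ I, deriv2 I f x ≠ 0) ∧ ∃ u : ℝ → ℝ, ContinuousOn u I ∧ JensenConvexOn I u ∧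
      (∀ x ∈ I, u x ≤ deriv1 I f x / deriv2 I f x) ∧ u y = -(1 / ρ y) := by
  -- The function `-(1 / ρ)` is controlled only in the interior; its supporting line at `y` is
  -- continuous and convex on all of `I`.
  obtain ⟨σ, hσ⟩ := exists_subgradient (s := interior I) (u := fun x => -(1 / ρ x)) hρc.neg
    (by rwa [interior_interior])
  set u : ℝ → ℝ := fun x => -(1 / ρ y) + σ * (x - y) with hu
  have huc : ContinuousOn u I := by fun_prop
  -- The division-free form passes to endpoints by continuity, and there it also excludes `f'' = 0`,
  -- because `f' > 0`.
  have hint : ∀ x ∈ interior I, deriv1 I f x ≤ u x * deriv2 I f x := by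
    intro x hx
    have h1 := hσ x hx
    have h2 := hle x hx
    have h3 := hρ x hx
    have h4 := hf.deriv2_nonpos hconc x
    have h5 : -(1 / ρ x) * deriv2 I f x ≤ u x * deriv2 I f x := mul_le_mul_of_nonpos_right h1 h4
    have h6 : deriv1 I f x ≤ -(1 / ρ x) * deriv2 I f x := by
      have e : -(1 / ρ x) * deriv2 I f x = -deriv2 I f x / ρ x := by ring
      rw [e, le_div_iff₀ h3]
      linarith
    exact h6.trans h5
  have hall := le_on_of_le_on_interior hI hI' (hf.contDiffOn_deriv1 hI hI').continuousOn
    (huc.mul (hf.continuousOn_deriv2 hI hI')) hint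
  have hne : ∀ x ∈ I, deriv2 I f x ≠ 0 := fun x hx h0 => by
    have h1 := hall x hx
    have h2 := hf.deriv1_pos hmono hx
    simp only [Pi.mul_apply, h0, mul_zero] at h1
    linarith
  refine ⟨hne, u, huc, fun a _ b _ => le_of_eq ?_, fun x hx => ?_, by simp [hu]⟩
  · simp only [hu, smul_eq_mul]
    ring
  · have h4 := lt_of_le_of_ne (hf.deriv2_nonpos hconc x) (hne x hx)
    rw [le_div_iff_of_neg h4]
    exact hall x hx

end Competitors

/-! ### The concave envelope in the two cases -/

section EnvelopeOfMeans

variable {I : Set ℝ} {f : ℝ → ℝ}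

/-- If `f''` vanishes nowhere and `f' / f''` has a continuous convex minorant, then the concave
envelope is generated by a solution `g` of `g' / g'' = conv (f' / f'')`. -/
theorem exists_generator_concaveEnvelopeQ_of_minorant (hI : I.OrdConnected) (hI' : I.Nontrivial)
    (hf : IsC2Sharp I f) (hmono : MonotoneOn f I) (hconc : ConcaveOn ℝ I f)
    (hne : ∀ x ∈ I, deriv2 I f x ≠ 0)
    (hu : ∃ u : ℝ → ℝ, ContinuousOn u I ∧ JensenConvexOn I u ∧
      ∀ x ∈ I, u x ≤ deriv1 I f x / deriv2 I f x) :
    ∃ g : ℝ → ℝ, IsC2Sharp I g ∧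
      (∀ p ∈ tuples I, concaveEnvelopeQ I (qaMean I f) p = (qaMean I g p : EReal)) ∧
      (∀ x ∈ I, deriv2 I g x ≠ 0) ∧
      ∀ x ∈ I, ((deriv1 I g x / deriv2 I g x : ℝ) : EReal) =
        convexEnvelopeC I (fun t => deriv1 I f t / deriv2 I f t) x := by
  have hfpos : ∀ x ∈ I, 0 < deriv1 I f x := fun x hx => hf.deriv1_pos hmono hx
  have hfd : ∀ x ∈ interior I, HasDerivAt f (deriv1 I f x) x := fun x hx =>
    (hf.hasDerivWithinAt (interior_subset hx)).hasDerivAt (mem_interior_iff_mem_nhds.1 hx)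
  have hfdd : ∀ x ∈ interior I, HasDerivAt (deriv1 I f) (deriv2 I f x) x := fun x hx =>
    (hf.hasDerivWithinAt_deriv1 hI hI' (interior_subset hx)).hasDerivAt
      (mem_interior_iff_mem_nhds.1 hx)
  have hfm := strictMonoOn_of_hasDerivWithinAt_pos hI (fun x hx => hf.hasDerivWithinAt hx) hfpos
  obtain ⟨c, hc⟩ := hI'.nonempty
  obtain ⟨u₀, h₀, hJ₀, hle₀⟩ := hu
  obtain ⟨ψ, hψc, hψconv, hψle, hψmax, hψeq⟩ := exists_eq_convexEnvelopeC hI h₀ hJ₀ hle₀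
  have hneg : ∀ x ∈ I, deriv2 I f x < 0 := fun x hx =>
    lt_of_le_of_ne (hf.deriv2_nonpos hconc x) (hne x hx)
  have hψneg : ∀ x ∈ I, ψ x < 0 := fun x hx =>
    (hψle x hx).trans_lt (div_neg_of_pos_of_neg (hfpos x hx) (hneg x hx))
  have hpc : ContinuousOn (fun x => (ψ x)⁻¹) I := hψc.inv₀ fun x hx => (hψneg x hx).ne
  -- Solves `g'' / g' = 1 / ψ` with `G = g'`.
  set G : ℝ → ℝ := fun x => Real.exp (∫ t in c..x, (ψ t)⁻¹) with hGdef
  have hGd : ∀ x ∈ I, HasDerivWithinAt G (G x * (ψ x)⁻¹) I x := fun x hx =>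
    (hasDerivWithinAt_integral hI hpc hc hx).exp
  have hGc : ContinuousOn G I := fun x hx => (hGd x hx).continuousWithinAt
  have hGpos : ∀ x ∈ I, 0 < G x := fun x _ => Real.exp_pos _
  set g : ℝ → ℝ := fun x => ∫ t in c..x, G t with hgdef
  have hgd : ∀ x ∈ I, HasDerivWithinAt g (G x) I x := fun x hx =>
    hasDerivWithinAt_integral hI hGc hc hx
  have hgc : ContinuousOn g I := fun x hx => (hgd x hx).continuousWithinAt
  have hgm := strictMonoOn_of_hasDerivWithinAt_pos hI hgd hGpos
  have hgJ : IsJensenConcaveMean I (qaMean I g) := by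
    refine isJensenConcaveMean_of_concaveOn hI (G := G) (U := fun x => -ψ x) hgd
      (fun x hx => ?_) hGpos (fun x hx => neg_pos.2 (hψneg x hx)) hψconv.neg
    have := hGd x hx
    rwa [show G x * (ψ x)⁻¹ = -G x / -ψ x by rw [neg_div_neg_eq, div_eq_mul_inv]] at this
  have hgd' : ∀ x ∈ interior I, HasDerivAt g (G x) x := fun x hx =>
    (hgd x (interior_subset hx)).hasDerivAt (mem_interior_iff_mem_nhds.1 hx)
  have hGd' : ∀ x ∈ interior I, HasDerivAt G (G x * (ψ x)⁻¹) x := fun x hx =>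
    (hGd x (interior_subset hx)).hasDerivAt (mem_interior_iff_mem_nhds.1 hx)
  refine ⟨g, isC2Sharp_of_hasDerivWithinAt hI hI' hgd hGd (hGc.mul hpc)
    fun x hx => (hGpos x hx).ne', fun p hp => ?_, fun x hx => ?_, fun x hx => ?_⟩
  · refine upperEnvelope_eq (S := {N | N ∈ quasiarithmeticMeans I ∧ IsJensenConcaveMean I N})
      (M := qaMean I g) ⟨⟨g, hgc, Or.inl hgm, fun _ _ => rfl⟩, hgJ⟩
      (fun z hz => ?_) fun N hN hfN => ?_
    · refine qaMean_le_qaMean hI hf.1.continuousOn hgc hfm hgm hfd hgd' hfdd hGd'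
        (fun x hx => hfpos x (interior_subset hx)) (fun x hx => ?_) hz
      have hxI := interior_subset hx
      have h1 := (le_div_iff_of_neg (hneg x hxI)).1 (hψle x hxI)
      have h2 : deriv2 I f x ≤ deriv1 I f x / ψ x := by
        rw [le_div_iff_of_neg (hψneg x hxI)]
        linarith
      calc deriv2 I f x * G x ≤ deriv1 I f x / ψ x * G x :=
            mul_le_mul_of_nonneg_right h2 (hGpos x hxI).le
        _ = _ := by rw [div_eq_mul_inv]; ring
    · obtain ⟨h, d, ρ, hhc, hhm, hNh, hd, hdpos, hdd, hle, hρ⟩ :=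
        exists_generator_of_competitor hI hI' hf hmono hN.1 hN.2 hfN
      rw [hNh p hp]
      refine qaMean_le_qaMean hI hgc hhc hgm hhm hgd' hd hGd' hdd
        (fun x hx => hGpos x (interior_subset hx)) (fun x hx => ?_) hp
      have hxI := interior_subset hx
      -- For a non-affine competitor, the supporting line touching `-(1 / ρ)` at `x` is a convex
      -- minorant of `f' / f''`, so `-(1 / ρ x) ≤ ψ x < 0`; then take reciprocals.
      have key : (ψ x)⁻¹ ≤ -ρ x := by
        rcases hρ with hρ | ⟨hρ, hρc⟩
        · rw [hρ x hx, neg_zero]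
          exact (inv_lt_zero.2 (hψneg x hxI)).le
        · obtain ⟨-, u, h1, h2, h3, h4⟩ :=
            exists_affine_minorant hI hI' hf hmono hconc hle hρ hρc hx
          have h5 := hψmax u h1 h2 h3 x hxI
          have h6 := hρ x hx
          rw [h4, one_div] at h5
          rw [← one_div, div_le_iff_of_neg (hψneg x hxI)]
          have h7 := mul_le_mul_of_nonneg_left h5 h6.le
          rw [mul_neg, mul_inv_cancel₀ h6.ne'] at h7
          linarith
      calc G x * (ψ x)⁻¹ * d x = (ψ x)⁻¹ * (d x * G x) := by ring
        _ ≤ -ρ x * (d x * G x) :=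
            mul_le_mul_of_nonneg_right key (mul_pos (hdpos x hx) (hGpos x hxI)).le
        _ = _ := by ring
  · rw [deriv2_eq hI hI' hgd hGd hx]
    exact mul_ne_zero (hGpos x hx).ne' (inv_ne_zero (hψneg x hx).ne)
  · rw [deriv2_eq hI hI' hgd hGd hx, deriv1_eq hI hI' hgd hx, hψeq x hx]
    have h1 := (hGpos x hx).ne'
    have h2 := (hψneg x hx).ne
    congr 1
    field_simp

/-- If `f''` has a zero or `f' / f''` has no continuous convex minorant, then the concave
envelope is the arithmetic mean. -/
theorem concaveEnvelopeQ_eq_of_not_minorant (hI : I.OrdConnected) (hI' : I.Nontrivial)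
    (hf : IsC2Sharp I f) (hmono : MonotoneOn f I) (hconc : ConcaveOn ℝ I f)
    (hcase : ¬((∀ x ∈ I, deriv2 I f x ≠ 0) ∧ ∃ u : ℝ → ℝ, ContinuousOn u I ∧
      JensenConvexOn I u ∧ ∀ x ∈ I, u x ≤ deriv1 I f x / deriv2 I f x)) {p : Tuple}
    (hp : p ∈ tuples I) :
    concaveEnvelopeQ I (qaMean I f) p = (qaMean I (fun x => x) p : EReal) := by
  have hfpos : ∀ x ∈ I, 0 < deriv1 I f x := fun x hx => hf.deriv1_pos hmono hx
  have hfd : ∀ x ∈ interior I, HasDerivAt f (deriv1 I f x) x := fun x hx =>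
    (hf.hasDerivWithinAt (interior_subset hx)).hasDerivAt (mem_interior_iff_mem_nhds.1 hx)
  have hfdd : ∀ x ∈ interior I, HasDerivAt (deriv1 I f) (deriv2 I f x) x := fun x hx =>
    (hf.hasDerivWithinAt_deriv1 hI hI' (interior_subset hx)).hasDerivAt
      (mem_interior_iff_mem_nhds.1 hx)
  have hfm := strictMonoOn_of_hasDerivWithinAt_pos hI (fun x hx => hf.hasDerivWithinAt hx) hfpos
  have hidm : StrictMonoOn (fun x : ℝ => x) I := fun _ _ _ _ h => h
  have hidc : ContinuousOn (fun x : ℝ => x) I := continuousOn_id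
  refine upperEnvelope_eq (S := {N | N ∈ quasiarithmeticMeans I ∧ IsJensenConcaveMean I N})
      (M := qaMean I fun x => x)
    ⟨⟨fun x => x, hidc, Or.inl hidm, fun _ _ => rfl⟩, ?_⟩ (fun z hz => ?_) fun N hN hfN => ?_
  · intro n hn x hx y hy
    have hxy : (2⁻¹ : ℝ) • (x + y) ∈ cube I n := fun i => by
      have := avg2_mem hI (hx i) (hy i)
      simpa [inv_mul_eq_div] using this
    beta_reduce
    rw [qaMean_id hI (p := ⟨n, x⟩) ⟨hn, hx⟩, qaMean_id hI (p := ⟨n, y⟩) ⟨hn, hy⟩,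
      qaMean_id hI (p := ⟨n, _⟩) ⟨hn, hxy⟩]
    simp only [arithMean, Pi.smul_apply, Pi.add_apply, smul_eq_mul, ← Finset.mul_sum,
      Finset.sum_add_distrib]
    exact le_of_eq (by ring)
  · refine qaMean_le_qaMean hI hf.1.continuousOn hidc hfm hidm hfd (d₂ := fun _ => 1)
      (e₂ := fun _ => 0) (fun x _ => hasDerivAt_id x) hfdd (fun x _ => hasDerivAt_const x 1)
      (fun x hx => hfpos x (interior_subset hx)) (fun x hx => ?_) hz
    have := hf.deriv2_nonpos hconc x
    linarith
  · obtain ⟨h, d, ρ, hhc, hhm, hNh, hd, hdpos, hdd, hle, hρ⟩ :=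
      exists_generator_of_competitor hI hI' hf hmono hN.1 hN.2 hfN
    -- A competitor with `ρ > 0` would make `f''` nonvanishing and supply an affine minorant, both
    -- of which `hcase` excludes together.
    have hρ0 : ∀ x ∈ interior I, ρ x = 0 := by
      rcases hρ with hρ | ⟨hρ, hρc⟩
      · exact hρ
      · intro x hx
        obtain ⟨h1, u, h2, h3, h4, -⟩ :=
          exists_affine_minorant hI hI' hf hmono hconc hle hρ hρc hx
        exact absurd ⟨h1, u, h2, h3, h4⟩ hcase
    rw [hNh p hp]
    refine qaMean_le_qaMean hI hidc hhc hidm hhm (d₁ := fun _ => 1) (e₁ := fun _ => 0)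
      (fun x _ => hasDerivAt_id x) hd (fun x _ => hasDerivAt_const x 1) hdd
      (fun _ _ => one_pos) (fun x hx => ?_) hp
    rw [hρ0 x hx]
    simp

end EnvelopeOfMeans

end QAMeans

/-! ### The theorem, by cases on the existence of a convex minorant -/

theorem mainTheorem3 (I : Set ℝ) (hI : I.OrdConnected) (hI' : I.Nontrivial)
    (f : ℝ → ℝ) (hf : QAMeans.IsC2Sharp I f) (hmono : MonotoneOn f I)
    (hconc : ConcaveOn ℝ I f) :
    ∃ g : ℝ → ℝ, QAMeans.IsC2Sharp I g ∧
      (∀ p ∈ QAMeans.tuples I,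
        QAMeans.concaveEnvelopeQ I (QAMeans.qaMean I f) p = (QAMeans.qaMean I g p : EReal)) ∧
      (((∀ x ∈ I, QAMeans.deriv2 I g x = 0) ∧
          ∀ p ∈ QAMeans.tuples I, QAMeans.qaMean I g p = QAMeans.arithMean p) ∨
        ((∀ x ∈ I, QAMeans.deriv2 I g x ≠ 0) ∧ (∀ x ∈ I, QAMeans.deriv2 I f x ≠ 0) ∧
          ∀ x ∈ I,
            ((QAMeans.deriv1 I g x / QAMeans.deriv2 I g x : ℝ) : EReal) =
              QAMeans.convexEnvelopeC I
                (fun t => QAMeans.deriv1 I f t / QAMeans.deriv2 I f t) x)) := by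
  by_cases hcase : (∀ x ∈ I, QAMeans.deriv2 I f x ≠ 0) ∧ ∃ u : ℝ → ℝ, ContinuousOn u I ∧
      QAMeans.JensenConvexOn I u ∧ ∀ x ∈ I, u x ≤ QAMeans.deriv1 I f x / QAMeans.deriv2 I f x
  · obtain ⟨g, hg, henv, hg2, hgf⟩ := QAMeans.exists_generator_concaveEnvelopeQ_of_minorant hI hI'
      hf hmono hconc hcase.1 hcase.2
    exact ⟨g, hg, henv, Or.inr ⟨hg2, hcase.1, hgf⟩⟩
  · have hid : ∀ x ∈ I, HasDerivWithinAt (fun x : ℝ => x) ((fun _ => (1 : ℝ)) x) I x :=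
      fun x _ => hasDerivWithinAt_id x I
    have hone : ∀ x ∈ I, HasDerivWithinAt (fun _ : ℝ => (1 : ℝ)) ((fun _ => (0 : ℝ)) x) I x :=
      fun x _ => hasDerivWithinAt_const x I 1
    exact ⟨fun x => x, QAMeans.isC2Sharp_of_hasDerivWithinAt hI hI' hid hone continuousOn_const
      fun _ _ => one_ne_zero,
      fun p hp => QAMeans.concaveEnvelopeQ_eq_of_not_minorant hI hI' hf hmono hconc hcase hp,
      Or.inl ⟨fun x hx => QAMeans.deriv2_eq hI hI' hid hone hx,
        fun p hp => QAMeans.qaMean_id hI hp⟩⟩
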